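/- A function $\Psi\colon[0,\infty)\to[0,\infty)$ is called an Orlicz function if it is convex, strictly increasing and $\Psi(0)=0$; write $\Psi(x)=e^{\psi(x)}-1$. Say that $\Psi$ satisfies (HJ) if there is a constant $K>0$ such that $\psi(su)\le K\bigl(s\ln(1+s)+s\psi(u)\bigr)$ for all $s,u\ge K$. For an Orlicz function $\Phi$ and a real random variable $Y$ put $\|Y\|_\Phi=\inf\{a>0:\mathbb E\,\Phi(|Y|/a)\le 1\}$ (with $\inf\emptyset=\infty$). **Proposition 4.6.** Let $\Psi$ be an Orlicz function satisfying (HJ) and let $\Phi(x)=\Psi(x^2)$, $x\ge 0$. There is a constant $c_\Phi\in(0,\infty)$, depending only on $\Phi$, such that the following holds. Let $X=(X_1,\dots,X_N)$ be an $\mathbb R^N$-valued random variable with independent coordinates such that $\bigl\|\max_{i\le N}|X_i|\bigr\|_\Phi<\infty$, and let $f\colon\mathbb R^N\to\mathbb R$ be convex and $1$-Lipschitz with respect to the Euclidean norm. Then $\max_{i\le N}|X_i|$ and $f(X)$ are integrable, and for every $t>0$ $$\mathbb P\bigl(|f(X)-\mathbb Ef(X)|>t\bigr)\le 2\exp\Bigl(-c_\Phi\frac{t^2}{(\mathbb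 E\max_{i\le N}|X_i|)^2}\Bigr)+\frac{2}{\Phi\Bigl(c_\Phi\frac{t}{\|\max_{i\le N}|X_i|\|_\Phi}\Bigr)+1},$$ where the right-hand side is read as $0$ if $X=0$ almost surely. -/

import Mathlib

open MeasureTheory ProbabilityTheory
open scoped ENNReal

noncomputable section

/-- An Orlicz function: convex, strictly increasing on `[0, ∞)` and zero at the origin (hence
nonnegative there). Only the values on `[0, ∞)` are meaningful. -/
structure IsOrlicz (Ψ : ℝ → ℝ) : Prop where
  convexOn : ConvexOn ℝ (Set.Ici 0) Ψ
  strictMonoOn : StrictMonoOn Ψ (Set.Ici 0)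
  map_zero : Ψ 0 = 0

/-- The exponent `ψ` of an Orlicz function, determined by `Ψ x = exp (ψ x) - 1` for `x ≥ 0`. -/
def orliczExponent (Ψ : ℝ → ℝ) (x : ℝ) : ℝ := Real.log (1 + Ψ x)

/-- The condition (HJ): for some `K > 0` and all `s, u ≥ K`,
`ψ (s u) ≤ K (s ln (1 + s) + s ψ(u))`. -/
def SatisfiesHJ (Ψ : ℝ → ℝ) : Prop :=
  ∃ K : ℝ, 0 < K ∧ ∀ s u : ℝ, K ≤ s → K ≤ u →
    orliczExponent Ψ (s * u) ≤ K * (s * Real.log (1 + s) + s * orliczExponent Ψ u)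

/-- The Orlicz (Luxemburg) norm `inf {a > 0 : E Ψ(|Y| / a) ≤ 1}`, with value `∞` if there is no
such `a`. -/
def orliczNorm {Ω : Type*} [MeasurableSpace Ω] (Ψ : ℝ → ℝ) (Y : Ω → ℝ) (μ : Measure Ω) : ℝ≥0∞ :=
  ⨅ (a : ℝ) (_ : 0 < a) (_ : ∫⁻ ω, ENNReal.ofReal (Ψ (|Y ω| / a)) ∂μ ≤ 1), ENNReal.ofReal a

/-- The random variable `max_i |X_i|` of finitely many real random variables. -/
def maxAbs {Ω : Type*} {N : ℕ} (X : Fin N → Ω → ℝ) (ω : Ω) : ℝ := ⨆ i, |X i ω|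

/-- The random vector in Euclidean space with coordinates `X_i`. -/
def randVec {Ω : Type*} {N : ℕ} (X : Fin N → Ω → ℝ) (ω : Ω) : EuclideanSpace ℝ (Fin N) :=
  WithLp.toLp 2 (fun i => X i ω)

end

/-!
Split each coordinate as `X i = X' i + X'' i`, where `X'' i` is the part of `X i` that is at least
`2 E max |X_i|` in absolute value.

The bounded vector `X'` is treated by Maurey's convex property (τ): with the infimum convolution
`(w □ f) x = inf_y (f y + w (x - y))` and a quadratic cost `w`, every convex `f` satisfies
`E exp (w □ f) · E exp (-f) ≤ 1`. The property holds for compactly supported laws on the line, it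
tensorizes, and for a Lipschitz `f` the function `w □ f` differs from `f` by at most a constant;
hence `f (X') - E f (X')` is subgaussian.

It remains to bound the tail of `|X''|`. By Markov's inequality all the other coordinates are small
with probability at least `1 / 2`, so by independence `∑ E H |X'' i| ≤ 2 E H (max |X_i|)` for every
`H ≥ 0` with `H 0 = 0`. Chernoff's bound for `∑ min (|X'' i|², v)` then reduces to moments of
`max |X_i|`, and (HJ) gives `exp (l z) - 1 ≤ C (1 + Ψ z)` for `0 ≤ z ≤ v` when `l` is of order
`ψ v / v`. Taking `v` proportional to `t` gives a bound of order `exp (-ψ v)`, which is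
`1 / (1 + Ψ v)`.
-/

section ExpMoment

variable {α : Type*} [MeasurableSpace α] {μ : Measure α} {g h : α → ℝ}

/-- The exponential moment `E exp (g)`, as an extended nonnegative number so that it makes sense
without integrability. -/
noncomputable def expMoment (μ : Measure α) (g : α → ℝ) : ℝ≥0∞ :=
  ∫⁻ x, ENNReal.ofReal (Real.exp (g x)) ∂μ

theorem expMoment_mono (hgh : ∀ x, g x ≤ h x) : expMoment μ g ≤ expMoment μ h :=
  lintegral_mono fun x => ENNReal.ofReal_le_ofReal (Real.exp_le_exp.2 (hgh x))

theorem expMoment_add_const (μ : Measure α) (g : α → ℝ) (c : ℝ) :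
    expMoment μ (fun x => g x + c) = expMoment μ g * ENNReal.ofReal (Real.exp c) := by
  simp only [expMoment, Real.exp_add, ENNReal.ofReal_mul (Real.exp_pos _).le]
  exact lintegral_mul_const' _ _ ENNReal.ofReal_ne_top

theorem expMoment_ne_zero [NeZero μ] (hg : Measurable g) : expMoment μ g ≠ 0 := by
  rw [expMoment, Ne, lintegral_eq_zero_iff (by fun_prop)]
  intro h0
  obtain ⟨x, hx⟩ := h0.exists
  exact (ENNReal.ofReal_pos.2 (Real.exp_pos _)).ne' hx

theorem ofReal_exp_le_expMoment [IsProbabilityMeasure μ] {b : ℝ} (hb : ∀ x, b ≤ g x) :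
    ENNReal.ofReal (Real.exp b) ≤ expMoment μ g := by
  simpa [expMoment] using expMoment_mono (μ := μ) hb

theorem ne_top_of_mul_le_one {x y : ℝ≥0∞} (h : x * y ≤ 1) (hy : y ≠ 0) : x ≠ ∞ := by
  rintro rfl
  simp [ENNReal.top_mul hy] at h

theorem convexOn_log_expMoment {E : Type*} [AddCommGroup E] [Module ℝ E] {h : E → α → ℝ}
    (hm : ∀ r, Measurable (h r)) (hc : ∀ x, ConvexOn ℝ Set.univ fun r => h r x)
    (h0 : ∀ r, expMoment μ (h r) ≠ 0) (htop : ∀ r, expMoment μ (h r) ≠ ∞) :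
    ConvexOn ℝ Set.univ fun r => Real.log (expMoment μ (h r)).toReal := by
  have hpos : ∀ r, 0 < (expMoment μ (h r)).toReal := fun r => ENNReal.toReal_pos (h0 r) (htop r)
  refine ⟨convex_univ, fun r _ r' _ a b ha hb hab => ?_⟩
  have hölder : expMoment μ (h (a • r + b • r')) ≤
      expMoment μ (h r) ^ a * expMoment μ (h r') ^ b := by
    refine le_trans (lintegral_mono fun x => ?_)
      (ENNReal.lintegral_mul_norm_pow_le (hm r).exp.ennreal_ofReal.aemeasurable
        (hm r').exp.ennreal_ofReal.aemeasurable ha hb hab)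
    rw [ENNReal.ofReal_rpow_of_pos (Real.exp_pos _), ENNReal.ofReal_rpow_of_pos (Real.exp_pos _),
      ← Real.exp_mul, ← Real.exp_mul, ← ENNReal.ofReal_mul (Real.exp_pos _).le, ← Real.exp_add]
    refine ENNReal.ofReal_le_ofReal (Real.exp_le_exp.2 ?_)
    simpa only [smul_eq_mul, mul_comm] using (hc x).2 (Set.mem_univ r) (Set.mem_univ r') ha hb hab
  have hreal := ENNReal.toReal_mono (ENNReal.mul_ne_top
    (ENNReal.rpow_ne_top_of_nonneg ha (htop r)) (ENNReal.rpow_ne_top_of_nonneg hb (htop r'))) hölder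
  rw [ENNReal.toReal_mul, ← ENNReal.toReal_rpow, ← ENNReal.toReal_rpow] at hreal
  refine (Real.log_le_log (hpos _) hreal).trans_eq ?_
  rw [Real.log_mul (Real.rpow_pos_of_pos (hpos _) _).ne' (Real.rpow_pos_of_pos (hpos _) _).ne',
    Real.log_rpow (hpos _), Real.log_rpow (hpos _)]
  rfl

/-- By Jensen's inequality `exp (-l E f) ≤ E exp (-l f)`, so the product bound controls the moment
generating function of `f - E f`. -/
theorem hasSubgaussianMGF_of_expMoment_mul_le [IsProbabilityMeasure μ] {f : α → ℝ}
    (hf : Measurable f) {c : NNReal}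
    (h : ∀ l : ℝ, 0 ≤ l → expMoment μ (fun x => l * f x) * expMoment μ (fun x => -(l * f x)) ≤
      ENNReal.ofReal (Real.exp (c * l ^ 2 / 2))) :
    HasSubgaussianMGF (fun x => f x - ∫ y, f y ∂μ) c μ := by
  have hprod : ∀ l : ℝ, expMoment μ (fun x => l * f x) * expMoment μ (fun x => -l * f x) ≤
      ENNReal.ofReal (Real.exp (c * l ^ 2 / 2)) := by
    intro l
    rcases le_total 0 l with hl | hl
    · simpa only [neg_mul] using h l hl
    · rw [mul_comm]
      simpa only [neg_mul, neg_neg, neg_sq] using h (-l) (neg_nonneg.2 hl)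
  have hint : ∀ l : ℝ, Integrable (fun x => Real.exp (l * f x)) μ := by
    intro l
    refine (lintegral_ofReal_ne_top_iff_integrable (by fun_prop)
      (ae_of_all _ fun x => (Real.exp_pos _).le)).1 fun htop => ?_
    have hl := hprod l
    rw [expMoment, htop, ENNReal.top_mul (expMoment_ne_zero (by fun_prop))] at hl
    exact ENNReal.ofReal_ne_top (top_le_iff.1 hl)
  have hmgf : ∀ l, expMoment μ (fun x => l * f x) = ENNReal.ofReal (mgf f μ l) := fun l =>
    (ofReal_integral_eq_lintegral_ofReal (hint l) (ae_of_all _ fun x => (Real.exp_pos _).le)).symm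
  have hfint : Integrable f μ := integrable_of_mem_interior_integrableExpSet <| by
    rw [show integrableExpSet f μ = Set.univ from Set.eq_univ_of_forall hint, interior_univ]
    exact Set.mem_univ 0
  have hjensen : ∀ l : ℝ, Real.exp (l * ∫ x, f x ∂μ) ≤ mgf f μ l := by
    intro l
    rw [← integral_const_mul]
    exact convexOn_exp.map_integral_le Real.continuous_exp.continuousOn isClosed_univ
      (ae_of_all _ fun _ => Set.mem_univ _) (hfint.const_mul l) (hint l)
  simp only [sub_eq_add_neg]
  refine ⟨fun l => ?_, fun l => ?_⟩
  · simpa only [mul_add, Real.exp_add] using (hint l).mul_const _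
  · rw [mgf_add_const, mul_neg, ← neg_mul]
    have hl := hprod l
    rw [hmgf, hmgf, ← ENNReal.ofReal_mul mgf_nonneg,
      ENNReal.ofReal_le_ofReal_iff (Real.exp_pos _).le] at hl
    exact (mul_le_mul_of_nonneg_left (hjensen (-l)) mgf_nonneg).trans hl

theorem measure_abs_ge_le_of_hasSubgaussianMGF [IsFiniteMeasure μ] {Z : α → ℝ} {c : NNReal}
    (hZ : HasSubgaussianMGF Z c μ) {t : ℝ} (ht : 0 ≤ t) :
    μ.real {x | t ≤ |Z x|} ≤ 2 * Real.exp (-t ^ 2 / (2 * c)) := by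
  have hunion : {x | t ≤ |Z x|} = {x | t ≤ Z x} ∪ {x | t ≤ (-Z) x} := by
    ext x
    simp [le_abs]
  rw [hunion, two_mul]
  exact (measureReal_union_le _ _).trans
    (add_le_add (hZ.measure_ge_le ht) (hZ.neg.measure_ge_le ht))

end ExpMoment

section Convex

variable {E F : Type*} [AddCommGroup E] [Module ℝ E] [AddCommGroup F] [Module ℝ F] {g : E × F → ℝ}

theorem convexOn_prodMk_left (hg : ConvexOn ℝ Set.univ g) (y : F) :
    ConvexOn ℝ Set.univ fun x => g (x, y) :=
  hg.comp_affineMap ((AffineMap.id ℝ E).prod (AffineMap.const ℝ E y))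

theorem convexOn_prodMk_right (hg : ConvexOn ℝ Set.univ g) (x : E) :
    ConvexOn ℝ Set.univ fun y => g (x, y) :=
  hg.comp_affineMap ((AffineMap.const ℝ F x).prod (AffineMap.id ℝ F))

theorem convexOn_iInf_snd (hg : ConvexOn ℝ Set.univ g)
    (hb : ∀ x, BddBelow (Set.range fun y => g (x, y))) :
    ConvexOn ℝ Set.univ fun x => ⨅ y, g (x, y) := by
  refine ⟨convex_univ, fun x _ x' _ a b ha hb' hab => le_of_forall_pos_le_add fun ε hε => ?_⟩
  obtain ⟨y, hy⟩ := exists_lt_of_ciInf_lt (lt_add_of_pos_right (⨅ y, g (x, y)) hε)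
  obtain ⟨y', hy'⟩ := exists_lt_of_ciInf_lt (lt_add_of_pos_right (⨅ y, g (x', y)) hε)
  calc ⨅ z, g (a • x + b • x', z) ≤ g (a • x + b • x', a • y + b • y') := ciInf_le (hb _) _
    _ ≤ a • g (x, y) + b • g (x', y') :=
        hg.2 (Set.mem_univ (x, y)) (Set.mem_univ (x', y')) ha hb' hab
    _ ≤ a • ((⨅ y, g (x, y)) + ε) + b • ((⨅ y, g (x', y)) + ε) := by gcongr
    _ = a • (⨅ y, g (x, y)) + b • (⨅ y, g (x', y)) + ε := by
        simp only [smul_eq_mul]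
        linear_combination ε * hab

end Convex

section InfConv

variable {E F : Type*} [AddCommGroup E] [AddCommGroup F]

/-- The infimum convolution of `f` with the cost `w`. In the lemmas `w` is nonnegative and `f`
bounded below, so that the infimum is not a junk value. -/
noncomputable def infConv (w f : E → ℝ) (x : E) : ℝ := ⨅ y, (f y + w (x - y))

variable {w f : E → ℝ}

theorem bddBelow_range_add (hw : 0 ≤ w) (hf : BddBelow (Set.range f)) (x : E) :
    BddBelow (Set.range fun y => f y + w (x - y)) := by
  obtain ⟨b, hb⟩ := hf
  refine ⟨b, ?_⟩
  rintro _ ⟨y, rfl⟩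
  exact (hb ⟨y, rfl⟩).trans (le_add_of_nonneg_right (hw _))

theorem infConv_le (hw : 0 ≤ w) (hf : BddBelow (Set.range f)) (x y : E) :
    infConv w f x ≤ f y + w (x - y) :=
  ciInf_le (bddBelow_range_add hw hf x) y

theorem le_infConv (hw : 0 ≤ w) {b : ℝ} (hb : ∀ x, b ≤ f x) (x : E) : b ≤ infConv w f x :=
  le_ciInf fun y => (hb y).trans (le_add_of_nonneg_right (hw _))

theorem infConv_prod_le {w₂ : F → ℝ} (hw : 0 ≤ w) (hw₂ : 0 ≤ w₂) {f : E × F → ℝ}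
    (hf : BddBelow (Set.range f)) (x r : E) (y : F) :
    infConv (fun p => w p.1 + w₂ p.2) f (x, y) ≤
      infConv w₂ (fun z => f (r, z)) y + w (x - r) := by
  rw [← sub_le_iff_le_add]
  refine le_ciInf fun z => ?_
  have := infConv_le (w := fun p : E × F => w p.1 + w₂ p.2)
    (fun p => add_nonneg (hw p.1) (hw₂ p.2)) hf (x, y) (r, z)
  simp only [Prod.mk_sub_mk] at this
  linarith

variable [Module ℝ E] [Module ℝ F]

theorem convexOn_infConv_snd {w : F → ℝ} (hw : 0 ≤ w) (hwc : ConvexOn ℝ Set.univ w) {f : E × F → ℝ}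
    (hfc : ConvexOn ℝ Set.univ f) (hf : BddBelow (Set.range f)) :
    ConvexOn ℝ Set.univ fun p : E × F => infConv w (fun z => f (p.1, z)) p.2 := by
  refine convexOn_iInf_snd (g := fun q : (E × F) × F => f (q.1.1, q.2) + w (q.1.2 - q.2)) ?_
    fun p => bddBelow_range_add hw (hf.mono (Set.range_comp_subset_range (Prod.mk p.1) f)) p.2
  exact (hfc.comp_linearMap ((LinearMap.fst ℝ E F).prodMap LinearMap.id)).add
    (hwc.comp_linearMap (LinearMap.snd ℝ E F ∘ₗ LinearMap.fst ℝ (E × F) F -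
      LinearMap.snd ℝ (E × F) F))

theorem infConv_map_le (e : F →ₗ[ℝ] E) (hw : 0 ≤ w) (hf : BddBelow (Set.range f)) (x : F) :
    infConv w f (e x) ≤ infConv (w ∘ e) (f ∘ e) x := by
  refine le_ciInf fun y => ?_
  simpa only [Function.comp_apply, map_sub] using infConv_le hw hf (e x) (e y)

end InfConv

theorem le_ofReal_exp_iInf {ι : Sort*} [Nonempty ι] {u : ι → ℝ} {c : ℝ≥0∞}
    (hu : BddBelow (Set.range u)) (h : ∀ i, c ≤ ENNReal.ofReal (Real.exp (u i))) :
    c ≤ ENNReal.ofReal (Real.exp (⨅ i, u i)) := by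
  have hcont : Continuous fun x => ENNReal.ofReal (Real.exp x) :=
    ENNReal.continuous_ofReal.comp Real.continuous_exp
  have hmono : Monotone fun x => ENNReal.ofReal (Real.exp x) :=
    ENNReal.ofReal_mono.comp Real.exp_monotone
  exact (le_iInf h).trans_eq (hmono.map_ciInf_of_continuousAt hcont.continuousAt hu).symm

section ConvexTau

/-- Maurey's convex property (τ) of `μ` with cost `w`: the inequality
`E exp (w □ f) · E exp (-f) ≤ 1` for convex `f`, with `□` the infimum convolution. -/
def ConvexTau {E : Type*} [AddCommGroup E] [Module ℝ E] [MeasurableSpace E] (w : E → ℝ)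
    (μ : Measure E) : Prop :=
  ∀ f : E → ℝ, ConvexOn ℝ Set.univ f → BddBelow (Set.range f) →
    expMoment μ (infConv w f) * expMoment μ (fun x => -f x) ≤ 1

namespace ConvexTau

theorem map {E F : Type*} [AddCommGroup E] [Module ℝ E] [MeasurableSpace E] [AddCommGroup F]
    [Module ℝ F] [MeasurableSpace F] {μ : Measure E} {w : F → ℝ} (e : E →ₗ[ℝ] F) (hw : 0 ≤ w)
    (hμ : ConvexTau (w ∘ e) μ) : ConvexTau w (μ.map e) := by
  intro f hfc hf
  calc expMoment (μ.map e) (infConv w f) * expMoment (μ.map e) (fun x => -f x)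
      ≤ expMoment μ (fun x => infConv w f (e x)) * expMoment μ (fun x => -f (e x)) :=
        mul_le_mul' (lintegral_map_le _ _) (lintegral_map_le _ _)
    _ ≤ expMoment μ (infConv (w ∘ e) (f ∘ e)) * expMoment μ (fun x => -f (e x)) :=
        mul_le_mul_left (expMoment_mono (infConv_map_le e hw hf)) _
    _ ≤ 1 := hμ (f ∘ e) (hfc.comp_linearMap e) (hf.mono (Set.range_comp_subset_range e f))

variable {E F : Type*} [AddCommGroup E] [Module ℝ E]
  [NormedAddCommGroup F] [NormedSpace ℝ F] [FiniteDimensional ℝ F] [MeasurableSpace F]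
  [BorelSpace F]

theorem exists_convexOn_expMoment_infConv_eq {ν : Measure F} [IsProbabilityMeasure ν] {w : F → ℝ}
    (hw : 0 ≤ w) (hwc : ConvexOn ℝ Set.univ w) (hν : ConvexTau w ν) {f : E × F → ℝ}
    (hfc : ConvexOn ℝ Set.univ f) (hf : BddBelow (Set.range f)) :
    ∃ φ : E → ℝ, ConvexOn ℝ Set.univ φ ∧ BddBelow (Set.range φ) ∧
      ∀ r, expMoment ν (infConv w fun y => f (r, y)) = ENNReal.ofReal (Real.exp (φ r)) := by
  set h : E → F → ℝ := fun r => infConv w fun y => f (r, y)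
  have hconv : ConvexOn ℝ Set.univ fun p : E × F => h p.1 p.2 :=
    convexOn_infConv_snd hw hwc hfc hf
  have hfr : ∀ r, ConvexOn ℝ Set.univ fun y => f (r, y) := convexOn_prodMk_right hfc
  have hmeas : ∀ r, Measurable (h r) := fun r =>
    (convexOn_prodMk_right hconv r).locallyLipschitz.continuous.measurable
  have h0 : ∀ r, expMoment ν (h r) ≠ 0 := fun r => expMoment_ne_zero (hmeas r)
  have htop : ∀ r, expMoment ν (h r) ≠ ∞ := fun r => ne_top_of_mul_le_one
    (hν _ (hfr r) (hf.mono (Set.range_comp_subset_range (Prod.mk r) f)))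
    (expMoment_ne_zero (hfr r).locallyLipschitz.continuous.measurable.neg)
  have hexp : ∀ r, expMoment ν (h r) =
      ENNReal.ofReal (Real.exp (Real.log (expMoment ν (h r)).toReal)) := fun r => by
    rw [Real.exp_log (ENNReal.toReal_pos (h0 r) (htop r)), ENNReal.ofReal_toReal (htop r)]
  refine ⟨_, convexOn_log_expMoment hmeas (convexOn_prodMk_left hconv) h0 htop, ?_, hexp⟩
  obtain ⟨b, hb⟩ := hf
  refine ⟨b, Set.forall_mem_range.2 fun r => Real.exp_le_exp.1 ?_⟩
  rw [← ENNReal.ofReal_le_ofReal_iff (Real.exp_pos _).le, ← hexp]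
  exact ofReal_exp_le_expMoment (le_infConv hw fun y => hb ⟨(r, y), rfl⟩)

theorem prod [MeasurableSpace E] {μ : Measure E} {ν : Measure F} [IsProbabilityMeasure ν]
    {w₁ : E → ℝ} {w₂ : F → ℝ} (hw₁ : 0 ≤ w₁) (hw₂ : 0 ≤ w₂) (hw₂c : ConvexOn ℝ Set.univ w₂)
    (hμ : ConvexTau w₁ μ) (hν : ConvexTau w₂ ν) :
    ConvexTau (fun p => w₁ p.1 + w₂ p.2) (μ.prod ν) := by
  intro f hfc hf
  obtain ⟨φ, hφc, hφ, hexp⟩ := exists_convexOn_expMoment_infConv_eq hw₂ hw₂c hν hfc hf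
  refine le_trans (mul_le_mul' ((lintegral_prod_le _).trans (lintegral_mono fun x => ?_))
    ((lintegral_prod_le _).trans (lintegral_mono fun r => ?_))) (hμ φ hφc hφ)
  · refine le_ofReal_exp_iInf (bddBelow_range_add hw₁ hφ x) fun r => ?_
    rw [Real.exp_add, ENNReal.ofReal_mul (Real.exp_pos _).le, ← hexp, ← expMoment_add_const]
    exact expMoment_mono (infConv_prod_le hw₁ hw₂ hf x r)
  · rw [Real.exp_neg, ENNReal.ofReal_inv_of_pos (Real.exp_pos _), ← hexp,
      ENNReal.le_inv_iff_mul_le, mul_comm]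
    exact hν _ (convexOn_prodMk_right hfc r)
      (hf.mono (Set.range_comp_subset_range (Prod.mk r) f))

end ConvexTau

end ConvexTau

section Compact

theorem exp_sub_add_exp_neg_le_two {u : ℝ} (h0 : 0 ≤ u) (h1 : u ≤ 1 / 4) :
    Real.exp (u - 2 * u ^ 2) + Real.exp (-u) ≤ 2 := by
  have hpos := (abs_le.1 (Real.abs_exp_sub_one_sub_id_le (x := u - 2 * u ^ 2)
    (by rw [abs_le]; constructor <;> nlinarith))).2
  have hneg := (abs_le.1 (Real.abs_exp_sub_one_sub_id_le (x := -u)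
    (by rw [abs_le]; constructor <;> nlinarith))).2
  have hsq : (u - 2 * u ^ 2) ^ 2 ≤ u ^ 2 := by
    apply pow_le_pow_left₀ <;> nlinarith
  nlinarith

theorem exp_eighth_add_exp_neg_le_two {u : ℝ} (h1 : 1 / 4 ≤ u) :
    Real.exp (1 / 8) + Real.exp (-u) ≤ 2 := by
  have hpos := (abs_le.1 (Real.abs_exp_sub_one_sub_id_le (x := 1 / 8)
    (by rw [abs_le]; constructor <;> norm_num))).2
  have hneg := (abs_le.1 (Real.abs_exp_sub_one_sub_id_le (x := -(1 / 4))
    (by rw [abs_le]; constructor <;> norm_num))).2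
  have hu : Real.exp (-u) ≤ Real.exp (-(1 / 4)) := Real.exp_le_exp.2 (by linarith)
  norm_num at hpos
  linarith

variable {E : Type*} [NormedAddCommGroup E] [NormedSpace ℝ E]

/-- The infimum convolution at `s` is tested on the segment from `s` to `a`; the optimal position
on it is at the fraction `4 (φ s - φ a)`, capped at the end point `a`. -/
theorem exp_infConv_sub_add_exp_sub_le_two {φ : E → ℝ} (hφ : ConvexOn ℝ Set.univ φ)
    (hb : BddBelow (Set.range φ)) {κ : ℝ} (hκ : 0 ≤ κ) {a s : E} (has : φ a ≤ φ s)
    (hdist : κ * ‖s - a‖ ^ 2 ≤ 1 / 8) :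
    Real.exp (infConv (fun z => κ * ‖z‖ ^ 2) φ s - φ a) + Real.exp (φ a - φ s) ≤ 2 := by
  obtain ⟨u, hu⟩ : ∃ u, u = φ s - φ a := ⟨_, rfl⟩
  have hu0 : 0 ≤ u := hu ▸ sub_nonneg.2 has
  have hsegment : ∀ θ : ℝ, 0 ≤ θ → θ ≤ 1 →
      infConv (fun z => κ * ‖z‖ ^ 2) φ s - φ a ≤ (1 - θ) * u + θ ^ 2 / 8 := by
    intro θ h0 h1
    have hle := infConv_le (w := fun z => κ * ‖z‖ ^ 2) (fun z => by positivity) hb s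
      ((1 - θ) • s + θ • a)
    have hconv := hφ.2 (Set.mem_univ s) (Set.mem_univ a) (sub_nonneg.2 h1) h0 (by ring)
    have hsub : s - ((1 - θ) • s + θ • a) = θ • (s - a) := by module
    rw [hsub, norm_smul, mul_pow, Real.norm_of_nonneg h0] at hle
    simp only [smul_eq_mul] at hconv
    have hcost := mul_le_mul_of_nonneg_left hdist (sq_nonneg θ)
    rw [hu]
    linarith
  rw [show φ a - φ s = -u by rw [hu, neg_sub]]
  rcases le_total u (1 / 4) with h | h
  · refine le_trans (add_le_add (Real.exp_le_exp.2 ?_) le_rfl) (exp_sub_add_exp_neg_le_two hu0 h)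
    exact (hsegment (4 * u) (by linarith) (by linarith)).trans_eq (by ring)
  · refine le_trans (add_le_add (Real.exp_le_exp.2 ?_) le_rfl) (exp_eighth_add_exp_neg_le_two h)
    simpa using hsegment 1 zero_le_one le_rfl

theorem mul_le_one_of_add_le_two {x y : ℝ≥0∞} (h : x + y ≤ 2) : x * y ≤ 1 := by
  have hx : x ≠ ∞ := ne_top_of_le_ne_top (by simp) (le_self_add.trans h)
  have hy : y ≠ ∞ := ne_top_of_le_ne_top (by simp) (le_add_self.trans h)
  lift x to NNReal using hx
  lift y to NNReal using hy
  norm_cast at h ⊢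
  rw [← NNReal.coe_le_coe] at h ⊢
  push_cast at h ⊢
  nlinarith [sq_nonneg ((x : ℝ) - y), x.2, y.2]

theorem convexTau_of_isCompact [FiniteDimensional ℝ E] [MeasurableSpace E] [BorelSpace E]
    (μ : Measure E) [IsProbabilityMeasure μ] {S : Set E} (hS : IsCompact S) (hμ : ∀ᵐ x ∂μ, x ∈ S)
    {κ : ℝ} (hκ : 0 ≤ κ) (hdiam : κ * Metric.diam S ^ 2 ≤ 1 / 8) :
    ConvexTau (fun z => κ * ‖z‖ ^ 2) μ := by
  intro φ hφ hb
  have hcont : Continuous φ := hφ.locallyLipschitz.continuous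
  obtain ⟨a, haS, hmin⟩ := hS.exists_isMinOn hμ.exists hcont.continuousOn
  have hdist : ∀ s ∈ S, κ * ‖s - a‖ ^ 2 ≤ 1 / 8 := fun s hs => hdiam.trans' <| by
    rw [← dist_eq_norm]
    gcongr
    exact Metric.dist_le_diam_of_mem hS.isBounded hs haS
  have hsum : expMoment μ (fun s => infConv (fun z => κ * ‖z‖ ^ 2) φ s + -φ a) +
      expMoment μ (fun s => -φ s + φ a) ≤ 2 := by
    rw [expMoment, expMoment, ← lintegral_add_right _ (by fun_prop)]
    calc _ ≤ ∫⁻ _, 2 ∂μ := lintegral_mono_ae <| hμ.mono fun s hs => by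
          rw [← ENNReal.ofReal_add (Real.exp_pos _).le (Real.exp_pos _).le, ← sub_eq_add_neg,
            neg_add_eq_sub]
          exact ENNReal.ofReal_le_of_le_toReal <| by
            simpa using exp_infConv_sub_add_exp_sub_le_two hφ hb hκ (hmin hs) (hdist s hs)
      _ = 2 := by simp
  have hprod := mul_le_one_of_add_le_two hsum
  rwa [expMoment_add_const, expMoment_add_const, mul_mul_mul_comm,
    ← ENNReal.ofReal_mul (Real.exp_pos _).le, ← Real.exp_add, neg_add_cancel, Real.exp_zero,
    ENNReal.ofReal_one, mul_one] at hprod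

end Compact

section Lipschitz

variable {E : Type*} [NormedAddCommGroup E]

theorem sub_le_infConv_of_lipschitzWith {K : NNReal} {f : E → ℝ} (hf : LipschitzWith K f) {κ : ℝ}
    (hκ : 0 < κ) (x : E) : f x - K ^ 2 / (4 * κ) ≤ infConv (fun z => κ * ‖z‖ ^ 2) f x := by
  refine le_ciInf fun y => ?_
  have hdist : f x - f y ≤ K * ‖x - y‖ := by
    rw [← dist_eq_norm]
    exact (le_abs_self _).trans (hf.dist_le_mul x y)
  have hsq : κ * ‖x - y‖ ^ 2 - K * ‖x - y‖ + K ^ 2 / (4 * κ) =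
      (2 * κ * ‖x - y‖ - K) ^ 2 / (4 * κ) := by
    field_simp
    ring
  have hnonneg : 0 ≤ (2 * κ * ‖x - y‖ - K) ^ 2 / (4 * κ) := by positivity
  linarith

variable [NormedSpace ℝ E] [MeasurableSpace E] {μ : Measure E} {κ : ℝ} {K : NNReal}
  {f : E → ℝ}

namespace ConvexTau

theorem expMoment_mul_expMoment_neg_le_of_bddBelow (hκ : 0 < κ)
    (hμ : ConvexTau (fun z => κ * ‖z‖ ^ 2) μ) (hfc : ConvexOn ℝ Set.univ f)
    (hfL : LipschitzWith K f) (hf : BddBelow (Set.range f)) :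
    expMoment μ f * expMoment μ (fun x => -f x) ≤
      ENNReal.ofReal (Real.exp (K ^ 2 / (4 * κ))) := by
  calc expMoment μ f * expMoment μ (fun x => -f x)
      ≤ expMoment μ (fun x => infConv (fun z => κ * ‖z‖ ^ 2) f x + K ^ 2 / (4 * κ)) *
          expMoment μ (fun x => -f x) := mul_le_mul_left (expMoment_mono fun x =>
        sub_le_iff_le_add.1 (sub_le_infConv_of_lipschitzWith hfL hκ x)) _
    _ = expMoment μ (infConv (fun z => κ * ‖z‖ ^ 2) f) * expMoment μ (fun x => -f x) *
          ENNReal.ofReal (Real.exp (K ^ 2 / (4 * κ))) := by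
        rw [expMoment_add_const, mul_right_comm]
    _ ≤ _ := mul_le_of_le_one_left' (hμ f hfc hf)

theorem expMoment_mul_expMoment_neg_le [BorelSpace E] (hκ : 0 < κ)
    (hμ : ConvexTau (fun z => κ * ‖z‖ ^ 2) μ) (hfc : ConvexOn ℝ Set.univ f)
    (hfL : LipschitzWith K f) :
    expMoment μ f * expMoment μ (fun x => -f x) ≤
      ENNReal.ofReal (Real.exp (K ^ 2 / (4 * κ))) := by
  set F : ℕ → E → ℝ := fun n x => max (f x) (-n) with hF
  have hbound : ∀ n, expMoment μ f * expMoment μ (fun x => -F n x) ≤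
      ENNReal.ofReal (Real.exp (K ^ 2 / (4 * κ))) := fun n =>
    (mul_le_mul_left (expMoment_mono fun x => le_max_left _ _) _).trans <|
      hμ.expMoment_mul_expMoment_neg_le_of_bddBelow hκ (hfc.sup (convexOn_const _ convex_univ))
        (hfL.max_const _) ⟨-n, Set.forall_mem_range.2 fun x => le_max_right _ _⟩
  have hsup : expMoment μ (fun x => -f x) = ⨆ n, expMoment μ fun x => -F n x := by
    have hfm : Measurable f := hfL.continuous.measurable
    have hanti : ∀ x, Antitone fun n => F n x := fun x m n hmn => by
      simp only [hF]
      gcongr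
    have hmono : Monotone fun n x => ENNReal.ofReal (Real.exp (-F n x)) := fun m n hmn x =>
      ENNReal.ofReal_le_ofReal (Real.exp_le_exp.2 (neg_le_neg (hanti x hmn)))
    simp only [expMoment]
    rw [← lintegral_iSup (fun n => by fun_prop) hmono]
    refine lintegral_congr fun x => le_antisymm ?_ (iSup_le fun n => ?_)
    · obtain ⟨n, hn⟩ := exists_nat_ge (-f x)
      refine le_iSup_of_le n (le_of_eq ?_)
      simp only [hF, max_eq_left (neg_le.1 hn)]
    · exact ENNReal.ofReal_le_ofReal (Real.exp_le_exp.2 (neg_le_neg (le_max_left _ _)))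
  rw [hsup, ENNReal.mul_iSup]
  exact iSup_le hbound

theorem hasSubgaussianMGF [BorelSpace E] [IsProbabilityMeasure μ] {κ : NNReal} (hκ : 0 < κ)
    (hμ : ConvexTau (fun z => κ * ‖z‖ ^ 2) μ) (hfc : ConvexOn ℝ Set.univ f)
    (hfL : LipschitzWith K f) :
    HasSubgaussianMGF (fun x => f x - ∫ y, f y ∂μ) (K ^ 2 / (2 * κ)) μ := by
  refine hasSubgaussianMGF_of_expMoment_mul_le hfL.continuous.measurable fun l hl => ?_
  have hlL : LipschitzWith (Real.toNNReal l * K) fun x => l * f x :=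
    (LipschitzWith.of_dist_le_mul fun a b => by
      rw [Real.coe_toNNReal l hl, dist_eq_norm, dist_eq_norm, ← mul_sub, norm_mul,
        Real.norm_of_nonneg hl]).comp hfL
  refine (hμ.expMoment_mul_expMoment_neg_le (NNReal.coe_pos.2 hκ) (hfc.smul hl) hlL).trans_eq ?_
  congr 2
  push_cast
  rw [Real.coe_toNNReal l hl]
  field_simp
  ring

end ConvexTau

end Lipschitz

section Product

theorem convexOn_sum_apply {ι E : Type*} [Fintype ι] [AddCommGroup E] [Module ℝ E] {w : ι → E → ℝ}
    (hw : ∀ i, ConvexOn ℝ Set.univ (w i)) :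
    ConvexOn ℝ Set.univ fun z : ι → E => ∑ i, w i (z i) := by
  refine ⟨convex_univ, fun x _ y _ a b ha hb hab => ?_⟩
  simp only [Finset.smul_sum, ← Finset.sum_add_distrib]
  exact Finset.sum_le_sum fun i _ => (hw i).2 (Set.mem_univ (x i)) (Set.mem_univ (y i)) ha hb hab

theorem map_consLinearEquiv_prod_pi {E : Type*} [AddCommGroup E] [Module ℝ E] [MeasurableSpace E]
    {n : ℕ} (μ : Fin (n + 1) → Measure E) [∀ i, SigmaFinite (μ i)] :
    ((μ 0).prod (Measure.pi fun i => μ i.succ)).map (Fin.consLinearEquiv ℝ fun _ => E) =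
      Measure.pi μ := by
  rw [← (measurePreserving_piFinSuccAbove μ 0).symm.map_eq]
  refine congrArg₂ Measure.map (funext fun p => ?_) rfl
  simp [Fin.consLinearEquiv, Fin.consEquiv, Fin.insertNthEquiv]

theorem convexTau_pi {E : Type*} [NormedAddCommGroup E] [NormedSpace ℝ E] [FiniteDimensional ℝ E]
    [MeasurableSpace E] [BorelSpace E] {n : ℕ} {w : Fin n → E → ℝ} (hw : ∀ i, 0 ≤ w i)
    (hwc : ∀ i, ConvexOn ℝ Set.univ (w i)) {μ : Fin n → Measure E}
    [∀ i, IsProbabilityMeasure (μ i)] (hμ : ∀ i, ConvexTau (w i) (μ i)) :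
    ConvexTau (fun z => ∑ i, w i (z i)) (Measure.pi μ) := by
  induction n with
  | zero =>
    simpa using convexTau_of_isCompact (Measure.pi μ) isCompact_univ (by simp) le_rfl (by simp)
  | succ n ih =>
    have hprod := (hμ 0).prod (hw 0) (fun z => Finset.sum_nonneg fun i _ => hw i.succ (z i))
      (convexOn_sum_apply fun i : Fin n => hwc i.succ)
      (ih (fun i => hw i.succ) (fun i => hwc i.succ) fun i => hμ i.succ)
    rw [← map_consLinearEquiv_prod_pi]
    refine ConvexTau.map (Fin.consLinearEquiv ℝ fun _ => E).toLinearMap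
      (fun z => Finset.sum_nonneg fun i _ => hw i (z i)) ?_
    convert hprod using 2 with p
    simp [Fin.consLinearEquiv, Fin.consEquiv, Fin.sum_univ_succ]

theorem convexTau_map_toLp_pi {κ : ℝ} (hκ : 0 ≤ κ) {n : ℕ} {μ : Fin n → Measure ℝ}
    [∀ i, IsProbabilityMeasure (μ i)] (hμ : ∀ i, ConvexTau (fun z => κ * ‖z‖ ^ 2) (μ i)) :
    ConvexTau (fun z : EuclideanSpace ℝ (Fin n) => κ * ‖z‖ ^ 2)
      ((Measure.pi μ).map (WithLp.toLp 2)) := by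
  refine ConvexTau.map (WithLp.linearEquiv 2 ℝ (Fin n → ℝ)).symm.toLinearMap
    (fun z => by positivity) ?_
  convert convexTau_pi (fun _ z => ?_) (fun _ => ?_) hμ using 2 with z
  · simp [EuclideanSpace.norm_sq_eq, Finset.mul_sum]
  · positivity
  · exact (convexOn_univ_norm.pow (fun _ _ => norm_nonneg _) 2).smul hκ

theorem measurable_randVec {Ω : Type*} [MeasurableSpace Ω] {n : ℕ} {X : Fin n → Ω → ℝ}
    (hX : ∀ i, Measurable (X i)) : Measurable (randVec X) :=
  (WithLp.measurable_toLp 2 (Fin n → ℝ)).comp (measurable_pi_lambda _ hX)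

theorem map_randVec_eq_map_toLp_pi {Ω : Type*} [MeasurableSpace Ω] {P : Measure Ω}
    [IsProbabilityMeasure P] {n : ℕ} {X : Fin n → Ω → ℝ} (hX : ∀ i, Measurable (X i))
    (hind : iIndepFun X P) :
    P.map (randVec X) = (Measure.pi fun i => P.map (X i)).map (WithLp.toLp 2) := by
  rw [← (iIndepFun_iff_map_fun_eq_pi_map fun i => (hX i).aemeasurable).1 hind,
    Measure.map_map (WithLp.measurable_toLp 2 (Fin n → ℝ)) (measurable_pi_lambda _ hX)]
  rfl

theorem hasSubgaussianMGF_comp_randVec {Ω : Type*} [MeasurableSpace Ω] {P : Measure Ω}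
    [IsProbabilityMeasure P] {n : ℕ} {X : Fin n → Ω → ℝ} {M : NNReal} (hM : 0 < M)
    (hX : ∀ i, Measurable (X i)) (hind : iIndepFun X P) (hb : ∀ i ω, |X i ω| ≤ M)
    {f : EuclideanSpace ℝ (Fin n) → ℝ} (hf : ConvexOn ℝ Set.univ f) {K : NNReal}
    (hL : LipschitzWith K f) :
    HasSubgaussianMGF (fun ω => f (randVec X ω) - ∫ ω', f (randVec X ω') ∂P)
      (16 * K ^ 2 * M ^ 2) P := by
  have (i : Fin n) : IsProbabilityMeasure (P.map (X i)) :=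
    Measure.isProbabilityMeasure_map (hX i).aemeasurable
  have : IsProbabilityMeasure (P.map (randVec X)) :=
    Measure.isProbabilityMeasure_map (measurable_randVec hX).aemeasurable
  set κ : NNReal := 1 / (32 * M ^ 2) with hκ
  have hcoord (i : Fin n) : ConvexTau (fun z => κ * ‖z‖ ^ 2) (P.map (X i)) := by
    refine convexTau_of_isCompact _ (isCompact_Icc (a := -(M : ℝ)) (b := M)) ?_ κ.2 ?_
    · exact (ae_map_iff (hX i).aemeasurable measurableSet_Icc).2
        (ae_of_all _ fun ω => abs_le.1 (hb i ω))
    · rw [Real.diam_Icc (by simp), hκ]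
      push_cast
      field_simp
      norm_num
  have hlaw : ConvexTau (fun z => κ * ‖z‖ ^ 2) (P.map (randVec X)) := by
    rw [map_randVec_eq_map_toLp_pi hX hind]
    exact convexTau_map_toLp_pi κ.2 hcoord
  have hsub := hlaw.hasSubgaussianMGF (by positivity) hf hL
  rw [integral_map (measurable_randVec hX).aemeasurable
    hL.continuous.measurable.aestronglyMeasurable] at hsub
  have hcomp := hsub.of_map (measurable_randVec hX).aemeasurable
  rwa [show K ^ 2 / (2 * κ) = 16 * K ^ 2 * M ^ 2 by rw [hκ]; field_simp; ring] at hcomp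

end Product

section LargeCoordinates

variable {Ω : Type*} {n : ℕ} {X : Fin n → Ω → ℝ} {M : ℝ}

theorem abs_le_maxAbs (X : Fin n → Ω → ℝ) (i : Fin n) (ω : Ω) : |X i ω| ≤ maxAbs X ω :=
  le_ciSup (f := fun i => |X i ω|) (Set.finite_range _).bddAbove i

theorem maxAbs_nonneg (X : Fin n → Ω → ℝ) (ω : Ω) : 0 ≤ maxAbs X ω :=
  Real.iSup_nonneg fun _ => abs_nonneg _

theorem maxAbs_div (X : Fin n → Ω → ℝ) {a : ℝ} (ha : 0 ≤ a) (ω : Ω) :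
    maxAbs (fun i ω => X i ω / a) ω = maxAbs X ω / a := by
  simp only [maxAbs, abs_div, abs_of_nonneg ha]
  simp only [div_eq_mul_inv]
  exact (Real.iSup_mul_of_nonneg (inv_nonneg.2 ha) _).symm

theorem maxAbs_eq_of_forall_ne {i : Fin n} {ω : Ω} (hi : M ≤ |X i ω|)
    (h : ∀ j ≠ i, |X j ω| < M) : maxAbs X ω = |X i ω| := by
  have : Nonempty (Fin n) := ⟨i⟩
  refine le_antisymm (ciSup_le fun j => ?_) (abs_le_maxAbs X i ω)
  obtain rfl | hj := eq_or_ne j i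
  · rfl
  · exact (h j hj).le.trans hi

theorem norm_randVec_le_sum (X : Fin n → Ω → ℝ) (ω : Ω) : ‖randVec X ω‖ ≤ ∑ i, |X i ω| := by
  rw [EuclideanSpace.norm_eq, Real.sqrt_le_iff]
  exact ⟨Finset.sum_nonneg fun i _ => abs_nonneg _,
    Finset.sum_sq_le_sq_sum_of_nonneg fun i _ => norm_nonneg _⟩

theorem norm_randVec_le_card_mul_maxAbs (X : Fin n → Ω → ℝ) (ω : Ω) :
    ‖randVec X ω‖ ≤ n * maxAbs X ω := by
  simpa using (norm_randVec_le_sum X ω).trans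
    (Finset.sum_le_sum fun i _ => abs_le_maxAbs X i ω)

/-- The hard truncation of `x` from below: the part of `x` that is at least `M` in absolute
value. Its complement `x - tailPart M x` is bounded by `M`. -/
noncomputable def tailPart (M x : ℝ) : ℝ := if M ≤ |x| then x else 0

theorem tailPart_of_lt {x : ℝ} (hx : |x| < M) : tailPart M x = 0 := if_neg hx.not_ge

theorem tailPart_of_le {x : ℝ} (hx : M ≤ |x|) : tailPart M x = x := if_pos hx

theorem abs_tailPart_le (M x : ℝ) : |tailPart M x| ≤ |x| := by
  unfold tailPart
  split_ifs <;> simp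

theorem abs_sub_tailPart_le (hM : 0 ≤ M) (x : ℝ) : |x - tailPart M x| ≤ M := by
  unfold tailPart
  split_ifs with hx
  · simpa using hM
  · simpa using (not_le.1 hx).le

theorem tailPart_div {a : ℝ} (ha : 0 < a) (x : ℝ) :
    tailPart (M / a) (x / a) = tailPart M x / a := by
  simp only [tailPart, abs_div, abs_of_pos ha, div_le_div_iff_of_pos_right ha]
  split_ifs <;> simp

theorem sum_indicator_tailPart_le {H : ℝ → ℝ≥0∞} (hH : H 0 = 0) (ω : Ω) :
    ∑ i, {ω | ∀ j ≠ i, |X j ω| < M}.indicator (fun ω => H |tailPart M (X i ω)|) ω ≤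
      H (maxAbs X ω) := by
  by_cases h : ∃ i, M ≤ |X i ω| ∧ ∀ j ≠ i, |X j ω| < M
  · obtain ⟨i, hi, hne⟩ := h
    rw [Finset.sum_eq_single i _ (by simp)]
    · rw [maxAbs_eq_of_forall_ne hi hne]
      exact (Set.indicator_le_self _ _ ω).trans (by rw [tailPart_of_le hi])
    · intro j _ hj
      simp [tailPart_of_lt (hne j hj), hH]
  · push Not at h
    rw [Finset.sum_eq_zero fun i _ => ?_]
    · exact zero_le
    · obtain hi | hi := lt_or_ge |X i ω| M
      · simp [tailPart_of_lt hi, hH]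
      · obtain ⟨j, hj, hjM⟩ := h i hi
        exact Set.indicator_of_notMem (fun hω => (hω j hj).not_ge hjM) _

variable [MeasurableSpace Ω] {μ : Measure Ω}

theorem measurable_maxAbs (hX : ∀ i, Measurable (X i)) : Measurable (maxAbs X) :=
  Measurable.iSup fun i => (hX i).abs

theorem measurable_tailPart (M : ℝ) : Measurable (tailPart M) :=
  Measurable.ite (measurableSet_le measurable_const measurable_id.abs) measurable_id
    measurable_const

theorem setLIntegral_forall_ne_mem_eq_mul {ι β : Type*} [Finite ι] [MeasurableSpace β]
    {Y : ι → Ω → β} (hY : ∀ i, Measurable (Y i)) (hind : iIndepFun Y μ) {B : Set β}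
    (hB : MeasurableSet B) {g : β → ℝ≥0∞} (hg : Measurable g) (i : ι) :
    ∫⁻ ω in {ω | ∀ j ≠ i, Y j ω ∈ B}, g (Y i ω) ∂μ =
      μ {ω | ∀ j ≠ i, Y j ω ∈ B} * ∫⁻ ω, g (Y i ω) ∂μ := by
  classical
  cases nonempty_fintype ι
  set A : Set Ω := {ω | ∀ j ≠ i, Y j ω ∈ B} with hA
  set rest : Ω → ↥(Finset.univ.erase i) → β := fun ω j => Y j ω
  have hrest : Measurable rest := measurable_pi_lambda _ fun j => hY j
  have hbox : MeasurableSet (Set.univ.pi fun _ : ↥(Finset.univ.erase i) => B) :=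
    MeasurableSet.univ_pi fun _ => hB
  have hA_eq : A = rest ⁻¹' Set.univ.pi fun _ => B := by
    ext ω
    simp [hA, rest]
  have hAm : MeasurableSet A := hA_eq ▸ hrest hbox
  have hindep : IndepFun (A.indicator fun _ => (1 : ℝ≥0∞)) (fun ω => g (Y i ω)) μ := by
    have hpair := (hind.indepFun_finset {i} (Finset.univ.erase i) (by simp) hY).symm
    rw [hA_eq]
    exact hpair.comp ((measurable_const (a := (1 : ℝ≥0∞))).indicator hbox)
      (hg.comp (measurable_pi_apply ⟨i, Finset.mem_singleton_self i⟩))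
  have hmul := lintegral_mul_eq_lintegral_mul_lintegral_of_indepFun''
    (measurable_const.indicator hAm).aemeasurable (hg.comp (hY i)).aemeasurable hindep
  rw [lintegral_indicator_const hAm, one_mul] at hmul
  rw [← lintegral_indicator hAm]
  refine Eq.trans (lintegral_congr fun ω => ?_) hmul
  by_cases hω : ω ∈ A <;> simp [hω]

theorem measure_mul_sum_lintegral_tailPart_le (hX : ∀ i, Measurable (X i))
    (hind : iIndepFun X μ) {H : ℝ → ℝ≥0∞} (hH : Measurable H) (hH0 : H 0 = 0) :
    μ {ω | maxAbs X ω < M} * ∑ i, ∫⁻ ω, H |tailPart M (X i ω)| ∂μ ≤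
      ∫⁻ ω, H (maxAbs X ω) ∂μ := by
  have hsmall (i : Fin n) : MeasurableSet {ω | ∀ j ≠ i, |X j ω| < M} := by
    simp only [Set.ofPred_forall]
    exact .iInter fun j => .iInter fun _ => measurableSet_lt (hX j).abs measurable_const
  have hg : Measurable fun x => H |tailPart M x| := hH.comp (measurable_tailPart M).abs
  calc _ = ∑ i, μ {ω | maxAbs X ω < M} * ∫⁻ ω, H |tailPart M (X i ω)| ∂μ := Finset.mul_sum ..
    _ ≤ ∑ i, μ {ω | ∀ j ≠ i, |X j ω| < M} * ∫⁻ ω, H |tailPart M (X i ω)| ∂μ := by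
        gcongr with i
        exact fun hω j _ => (abs_le_maxAbs X j _).trans_lt hω
    _ = ∑ i, ∫⁻ ω, {ω | ∀ j ≠ i, |X j ω| < M}.indicator
          (fun ω => H |tailPart M (X i ω)|) ω ∂μ := by
        refine Finset.sum_congr rfl fun i _ => ?_
        rw [lintegral_indicator (hsmall i)]
        exact (setLIntegral_forall_ne_mem_eq_mul hX hind
          (measurableSet_lt measurable_id.abs measurable_const) hg i).symm
    _ = ∫⁻ ω, ∑ i, {ω | ∀ j ≠ i, |X j ω| < M}.indicator
          (fun ω => H |tailPart M (X i ω)|) ω ∂μ :=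
        (lintegral_finsetSum _ fun i _ => (hg.comp (hX i)).indicator (hsmall i)).symm
    _ ≤ _ := lintegral_mono fun ω => sum_indicator_tailPart_le hH0 ω

theorem sum_lintegral_tailPart_le (hX : ∀ i, Measurable (X i)) (hind : iIndepFun X μ)
    (hM : 1 / 2 ≤ μ {ω | maxAbs X ω < M}) {H : ℝ → ℝ≥0∞} (hH : Measurable H) (hH0 : H 0 = 0) :
    ∑ i, ∫⁻ ω, H |tailPart M (X i ω)| ∂μ ≤ 2 * ∫⁻ ω, H (maxAbs X ω) ∂μ := by
  rw [← ENNReal.div_le_iff' (by simp) (by simp), ENNReal.div_eq_inv_mul, ← one_div]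
  exact (mul_le_mul_left hM _).trans (measure_mul_sum_lintegral_tailPart_le hX hind hH hH0)

theorem half_le_measure_lt_two_mul_integral [IsProbabilityMeasure μ] {Y : Ω → ℝ}
    (hY0 : ∀ ω, 0 ≤ Y ω) (hY : Measurable Y) (hint : Integrable Y μ) (hpos : 0 < ∫ ω, Y ω ∂μ) :
    1 / 2 ≤ μ {ω | Y ω < 2 * ∫ ω', Y ω' ∂μ} := by
  set m := ∫ ω, Y ω ∂μ
  have hmarkov := mul_meas_ge_le_integral_of_nonneg (ae_of_all _ hY0) hint (2 * m)
  have hcompl := probReal_compl_eq_one_sub (μ := μ) (measurableSet_le measurable_const hY :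
    MeasurableSet {ω | 2 * m ≤ Y ω})
  have hset : {ω | 2 * m ≤ Y ω}ᶜ = {ω | Y ω < 2 * m} := by
    ext ω
    simp
  have hhalf : 1 / 2 ≤ μ.real {ω | Y ω < 2 * m} := by
    rw [← hset, hcompl]
    nlinarith
  rw [← ofReal_measureReal, ← ENNReal.ofReal_one, ← ENNReal.ofReal_ofNat,
    ← ENNReal.ofReal_div_of_pos zero_lt_two]
  exact ENNReal.ofReal_le_ofReal hhalf

end LargeCoordinates

section Orlicz

variable {Ψ : ℝ → ℝ}

namespace IsOrlicz

theorem mono (h : IsOrlicz Ψ) {x y : ℝ} (hx : 0 ≤ x) (hxy : x ≤ y) : Ψ x ≤ Ψ y :=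
  h.strictMonoOn.monotoneOn (Set.mem_Ici.2 hx) (Set.mem_Ici.2 (hx.trans hxy)) hxy

theorem nonneg (h : IsOrlicz Ψ) {x : ℝ} (hx : 0 ≤ x) : 0 ≤ Ψ x :=
  h.map_zero.symm.trans_le (h.mono le_rfl hx)

theorem pos (h : IsOrlicz Ψ) {x : ℝ} (hx : 0 < x) : 0 < Ψ x :=
  h.map_zero.symm.trans_lt (h.strictMonoOn Set.self_mem_Ici hx.le hx)

theorem map_mul_le (h : IsOrlicz Ψ) {θ x : ℝ} (h0 : 0 ≤ θ) (h1 : θ ≤ 1) (hx : 0 ≤ x) :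
    Ψ (θ * x) ≤ θ * Ψ x := by
  simpa [h.map_zero] using h.convexOn.2 (Set.mem_Ici.2 hx) (Set.mem_Ici.2 le_rfl) h0
    (sub_nonneg.2 h1) (by ring)

theorem le_one_add_map_div (h : IsOrlicz Ψ) {x : ℝ} (hx : 0 ≤ x) : x ≤ 1 + Ψ x / Ψ 1 := by
  have h1 : 0 < Ψ 1 := h.pos one_pos
  obtain hx1 | hx1 := le_total x 1
  · have : 0 ≤ Ψ x / Ψ 1 := div_nonneg (h.nonneg hx) h1.le
    linarith
  · have hx0 : 0 < x := one_pos.trans_le hx1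
    have hscale := h.map_mul_le (inv_nonneg.2 hx) (inv_le_one_of_one_le₀ hx1) hx
    rw [inv_mul_cancel₀ hx0.ne', inv_mul_eq_div, le_div_iff₀ hx0, mul_comm,
      ← le_div_iff₀ h1] at hscale
    linarith

theorem exp_orliczExponent (h : IsOrlicz Ψ) {x : ℝ} (hx : 0 ≤ x) :
    Real.exp (orliczExponent Ψ x) = 1 + Ψ x :=
  Real.exp_log (by linarith [h.nonneg hx])

theorem orliczExponent_nonneg (h : IsOrlicz Ψ) {x : ℝ} (hx : 0 ≤ x) : 0 ≤ orliczExponent Ψ x :=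
  Real.log_nonneg (by linarith [h.nonneg hx])

theorem orliczExponent_mono (h : IsOrlicz Ψ) {x y : ℝ} (hx : 0 ≤ x) (hxy : x ≤ y) :
    orliczExponent Ψ x ≤ orliczExponent Ψ y :=
  Real.log_le_log (by linarith [h.nonneg hx]) (by linarith [h.mono hx hxy])

theorem orliczExponent_max_le (h : IsOrlicz Ψ) {x y : ℝ} (hx : 0 ≤ x) (hy : 0 ≤ y) :
    orliczExponent Ψ (max x y) ≤ orliczExponent Ψ x + orliczExponent Ψ y := by
  have hψx := h.orliczExponent_nonneg hx
  have hψy := h.orliczExponent_nonneg hy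
  obtain hxy | hxy := le_total x y
  · simpa [max_eq_right hxy] using hψx
  · simpa [max_eq_left hxy] using hψy

end IsOrlicz

namespace SatisfiesHJ

theorem exists_one_le (h : IsOrlicz Ψ) (hHJ : SatisfiesHJ Ψ) :
    ∃ K : ℝ, 1 ≤ K ∧ ∀ s u : ℝ, K ≤ s → K ≤ u →
      orliczExponent Ψ (s * u) ≤ K * (s * Real.log (1 + s) + s * orliczExponent Ψ u) := by
  obtain ⟨K, hK, H⟩ := hHJ
  refine ⟨max K 1, le_max_right _ _, fun s u hs hu => ?_⟩
  have hs0 : 0 < s := hK.trans_le ((le_max_left _ _).trans hs)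
  have hu0 : 0 < u := hK.trans_le ((le_max_left _ _).trans hu)
  have hlog : 0 ≤ Real.log (1 + s) := Real.log_nonneg (by linarith)
  have hψ := h.orliczExponent_nonneg hu0.le
  exact (H s u ((le_max_left _ _).trans hs) ((le_max_left _ _).trans hu)).trans
    (mul_le_mul_of_nonneg_right (le_max_left _ _) (by positivity))

theorem exists_orliczExponent_mul_le (h : IsOrlicz Ψ) (hHJ : SatisfiesHJ Ψ) :
    ∃ A C : ℝ, 1 ≤ A ∧ ∀ s z : ℝ, 1 ≤ s → 0 ≤ z →
      orliczExponent Ψ (s * z) ≤ A * s * (Real.log (1 + s) + orliczExponent Ψ z + C) := by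
  obtain ⟨K, hK, H⟩ := hHJ.exists_one_le h
  refine ⟨K ^ 2, Real.log (1 + K) + orliczExponent Ψ K, one_le_pow₀ hK, fun s z hs hz => ?_⟩
  have hK0 : 0 ≤ K := zero_le_one.trans hK
  have : 0 ≤ s := zero_le_one.trans hs
  have := h.orliczExponent_nonneg hz
  have := h.orliczExponent_nonneg hK0
  have hlog : Real.log (1 + max s K) ≤ Real.log (1 + s) + Real.log (1 + K) := by
    rw [← Real.log_mul (by positivity) (by positivity)]
    exact Real.log_le_log (by positivity) (by rcases max_cases s K with h | h <;> nlinarith)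
  have hmax : max s K ≤ K * s := max_le (by nlinarith) (by nlinarith)
  have hlog0 : 0 ≤ Real.log (1 + max s K) := Real.log_nonneg (by linarith [le_max_left s K])
  have hψmax := h.orliczExponent_nonneg (hz.trans (le_max_left z K))
  calc orliczExponent Ψ (s * z) ≤ orliczExponent Ψ (max s K * max z K) :=
        h.orliczExponent_mono (by positivity) (by gcongr <;> exact le_max_left _ _)
    _ ≤ K * max s K * (Real.log (1 + max s K) + orliczExponent Ψ (max z K)) :=
        (H _ _ (le_max_right _ _) (le_max_right _ _)).trans_eq (by ring)
    _ ≤ K * (K * s) * (Real.log (1 + s) + Real.log (1 + K) +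
          (orliczExponent Ψ z + orliczExponent Ψ K)) := by
        gcongr
        exact h.orliczExponent_max_le hz hK0
    _ = _ := by ring

theorem exists_exp_mul_sub_one_le (h : IsOrlicz Ψ) (hHJ : SatisfiesHJ Ψ) :
    ∃ A D : ℝ, 1 ≤ A ∧ 0 ≤ D ∧ ∀ v z : ℝ, 0 ≤ z → z ≤ v →
      Real.exp (orliczExponent Ψ v / (A * v) * z) - 1 ≤ D * orliczExponent Ψ v * (1 + Ψ z) := by
  obtain ⟨A, C, hA, H⟩ := hHJ.exists_orliczExponent_mul_le h
  refine ⟨A, 2 * Real.exp C, hA, by positivity, fun v z hz hzv => ?_⟩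
  have hψv := h.orliczExponent_nonneg (hz.trans hzv)
  have hΨz := h.nonneg hz
  obtain rfl | hz0 := hz.eq_or_lt
  · rw [mul_zero, Real.exp_zero, sub_self]
    positivity
  set s := v / z with hs
  set x := orliczExponent Ψ v / (A * v) * z with hx
  have hs1 : 1 ≤ s := (one_le_div hz0).2 hzv
  have hv0 : 0 < v := hz0.trans_le hzv
  have hxs : x * (A * s) = orliczExponent Ψ v := by
    rw [hx, hs]
    field_simp
  have hx0 : 0 ≤ x := by positivity
  have hexp : Real.exp x ≤ (1 + s) * (1 + Ψ z) * Real.exp C := by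
    rw [← h.exp_orliczExponent hz, ← Real.exp_log (show 0 < 1 + s by positivity),
      ← Real.exp_add, ← Real.exp_add, Real.exp_le_exp]
    have hHJs := H s z hs1 hz
    rw [hs, div_mul_cancel₀ _ hz0.ne', ← hs, ← hxs, mul_comm] at hHJs
    exact le_of_mul_le_mul_left hHJs (by positivity)
  have hlin : x * (1 + s) ≤ 2 * orliczExponent Ψ v := by
    rw [← hxs]
    nlinarith [mul_le_mul_of_nonneg_left hA (by positivity : 0 ≤ x * s)]
  have hbase : Real.exp x - 1 ≤ x * Real.exp x := by
    have := mul_le_mul_of_nonneg_left (Real.one_sub_le_exp_neg x) (Real.exp_pos x).le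
    rw [← Real.exp_add, add_neg_cancel, Real.exp_zero] at this
    linarith
  calc Real.exp x - 1 ≤ x * ((1 + s) * (1 + Ψ z) * Real.exp C) := hbase.trans (by gcongr)
    _ = x * (1 + s) * ((1 + Ψ z) * Real.exp C) := by ring
    _ ≤ 2 * orliczExponent Ψ v * ((1 + Ψ z) * Real.exp C) := by gcongr
    _ = _ := by ring

end SatisfiesHJ

variable {Ω : Type*} [MeasurableSpace Ω] {μ : Measure Ω} [IsProbabilityMeasure μ]

theorem lintegral_one_add_le_two (h : IsOrlicz Ψ) {Y : Ω → ℝ} (hY0 : ∀ ω, 0 ≤ Y ω)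
    (hΨY : ∫⁻ ω, ENNReal.ofReal (Ψ (Y ω)) ∂μ ≤ 1) :
    ∫⁻ ω, ENNReal.ofReal (1 + Ψ (Y ω)) ∂μ ≤ 2 := by
  simp_rw [ENNReal.ofReal_add zero_le_one (h.nonneg (hY0 _)), ENNReal.ofReal_one]
  rw [lintegral_add_left measurable_const, lintegral_const, measure_univ, mul_one,
    ← one_add_one_eq_two]
  gcongr

theorem measureReal_lt_le_two_div (h : IsOrlicz Ψ) {Y : Ω → ℝ} (hY : Measurable Y)
    (hY0 : ∀ ω, 0 ≤ Y ω) (hΨY : ∫⁻ ω, ENNReal.ofReal (Ψ (Y ω)) ∂μ ≤ 1) {v : ℝ} (hv : 0 ≤ v) :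
    μ.real {ω | v < Y ω} ≤ 2 / (1 + Ψ v) := by
  have hΨv := h.nonneg hv
  have hpos : 0 < 1 + Ψ v := by positivity
  have hmarkov : ENNReal.ofReal (1 + Ψ v) * μ {ω | v < Y ω} ≤ 2 := by
    calc _ = ∫⁻ _ in {ω | v < Y ω}, ENNReal.ofReal (1 + Ψ v) ∂μ := (setLIntegral_const _ _).symm
      _ ≤ ∫⁻ ω in {ω | v < Y ω}, ENNReal.ofReal (1 + Ψ (Y ω)) ∂μ :=
          setLIntegral_mono' (measurableSet_lt measurable_const hY) fun ω hω =>
            ENNReal.ofReal_le_ofReal (add_le_add le_rfl (h.mono hv (le_of_lt hω)))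
      _ ≤ ∫⁻ ω, ENNReal.ofReal (1 + Ψ (Y ω)) ∂μ := setLIntegral_le_lintegral _ _
      _ ≤ 2 := lintegral_one_add_le_two h hY0 hΨY
  rw [le_div_iff₀' hpos]
  simpa [ENNReal.toReal_mul, hpos.le, measureReal_def] using
    ENNReal.toReal_mono (by simp) hmarkov

end Orlicz

section LargeCoordinatesTail

variable {Ω : Type*} [MeasurableSpace Ω] {μ : Measure Ω} [IsProbabilityMeasure μ]

theorem measure_sum_ge_le_exp_sum_integral_exp_sub_one {ι : Type*} [Fintype ι] {W : ι → Ω → ℝ}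
    (hW : ∀ i, Measurable (W i)) (hind : iIndepFun W μ) {l : ℝ} (hl : 0 ≤ l)
    (hint : ∀ i, Integrable (fun ω => Real.exp (l * W i ω)) μ) (t : ℝ) :
    μ.real {ω | t ≤ ∑ i, W i ω} ≤
      Real.exp (-l * t + ∑ i, ∫ ω, (Real.exp (l * W i ω) - 1) ∂μ) := by
  have hmgf (i : ι) : mgf (W i) μ l ≤ Real.exp (∫ ω, (Real.exp (l * W i ω) - 1) ∂μ) := by
    rw [integral_sub (hint i) (integrable_const _)]
    simpa [mgf] using Real.add_one_le_exp (mgf (W i) μ l - 1)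
  have hchernoff := measure_ge_le_exp_mul_mgf t hl
    (hind.integrable_exp_mul_sum hW (s := Finset.univ) fun i _ => hint i)
  rw [hind.mgf_sum hW] at hchernoff
  simp only [Finset.sum_apply] at hchernoff
  rw [Real.exp_add, Real.exp_sum]
  exact hchernoff.trans (mul_le_mul_of_nonneg_left
    (Finset.prod_le_prod (fun _ _ => mgf_nonneg) fun i _ => hmgf i) (Real.exp_pos _).le)

theorem integrable_exp_mul_min {Y : Ω → ℝ} (hY : Measurable Y) {l v : ℝ} (hl : 0 ≤ l) :
    Integrable (fun ω => Real.exp (l * min (Y ω) v)) μ := by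
  refine Integrable.of_bound (by fun_prop) (Real.exp (l * v)) (ae_of_all _ fun ω => ?_)
  rw [Real.norm_of_nonneg (Real.exp_pos _).le, Real.exp_le_exp]
  exact mul_le_mul_of_nonneg_left (min_le_right _ _) hl

variable {n : ℕ} {X : Fin n → Ω → ℝ} {M : ℝ} {Ψ : ℝ → ℝ}

theorem sum_integral_exp_min_sq_tailPart_sub_one_le (hX : ∀ i, Measurable (X i))
    (hind : iIndepFun X μ) (hM : 1 / 2 ≤ μ {ω | maxAbs X ω < M}) (h : IsOrlicz Ψ)
    (hΨ : ∫⁻ ω, ENNReal.ofReal (Ψ (maxAbs X ω ^ 2)) ∂μ ≤ 1) {l v C : ℝ} (hl : 0 ≤ l)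
    (hv : 0 ≤ v) (hC : 0 ≤ C)
    (hexp : ∀ z, 0 ≤ z → z ≤ v → Real.exp (l * z) - 1 ≤ C * (1 + Ψ z)) :
    ∑ i, ∫ ω, (Real.exp (l * min (tailPart M (X i ω) ^ 2) v) - 1) ∂μ ≤ 4 * C := by
  set G : ℝ → ℝ := fun y => Real.exp (l * min (y ^ 2) v) - 1 with hG
  have hG0 (y : ℝ) : 0 ≤ G y := sub_nonneg.2 (Real.one_le_exp (by positivity))
  have hGΨ (y : ℝ) : G y ≤ C * (1 + Ψ (y ^ 2)) := by
    refine (hexp _ (by positivity) (min_le_right _ _)).trans ?_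
    gcongr
    exact h.mono (by positivity) (min_le_left _ _)
  have hGint (i : Fin n) : Integrable (fun ω => G (tailPart M (X i ω))) μ :=
    (integrable_exp_mul_min (((measurable_tailPart M).comp (hX i)).pow_const 2) hl).sub
      (integrable_const _)
  have hmax : ∫⁻ ω, ENNReal.ofReal (G (maxAbs X ω)) ∂μ ≤ ENNReal.ofReal C * 2 := by
    calc _ ≤ ∫⁻ ω, ENNReal.ofReal C * ENNReal.ofReal (1 + Ψ (maxAbs X ω ^ 2)) ∂μ :=
          lintegral_mono fun ω => by
            rw [← ENNReal.ofReal_mul hC]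
            exact ENNReal.ofReal_le_ofReal (hGΨ _)
      _ = ENNReal.ofReal C * ∫⁻ ω, ENNReal.ofReal (1 + Ψ (maxAbs X ω ^ 2)) ∂μ :=
          lintegral_const_mul' _ _ ENNReal.ofReal_ne_top
      _ ≤ _ := by
          gcongr
          exact lintegral_one_add_le_two h (fun ω => sq_nonneg (maxAbs X ω)) hΨ
  rw [← ENNReal.ofReal_le_ofReal_iff (by positivity),
    ENNReal.ofReal_sum_of_nonneg fun i _ => integral_nonneg fun ω => hG0 _]
  calc _ = ∑ i, ∫⁻ ω, ENNReal.ofReal (G |tailPart M (X i ω)|) ∂μ :=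
        Finset.sum_congr rfl fun i _ => by
          simpa only [hG, sq_abs] using
            ofReal_integral_eq_lintegral_ofReal (hGint i) (ae_of_all _ fun ω => hG0 _)
    _ ≤ 2 * ∫⁻ ω, ENNReal.ofReal (G (maxAbs X ω)) ∂μ :=
        sum_lintegral_tailPart_le hX hind hM (H := fun y => ENNReal.ofReal (G y)) (by fun_prop)
          (by simp [hG, hv])
    _ ≤ 2 * (ENNReal.ofReal C * 2) := by gcongr
    _ = ENNReal.ofReal (4 * C) := by
        rw [ENNReal.ofReal_mul (by norm_num), ENNReal.ofReal_ofNat]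
        ring

theorem measure_lt_sum_sq_tailPart_le_add (hX : ∀ i, Measurable (X i)) (hind : iIndepFun X μ)
    (hM : 1 / 2 ≤ μ {ω | maxAbs X ω < M}) (h : IsOrlicz Ψ)
    (hΨ : ∫⁻ ω, ENNReal.ofReal (Ψ (maxAbs X ω ^ 2)) ∂μ ≤ 1) {l v C : ℝ} (hl : 0 ≤ l)
    (hv : 0 ≤ v) (hC : 0 ≤ C)
    (hexp : ∀ z, 0 ≤ z → z ≤ v → Real.exp (l * z) - 1 ≤ C * (1 + Ψ z)) (t : ℝ) :
    μ.real {ω | t < ∑ i, tailPart M (X i ω) ^ 2} ≤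
      Real.exp (-l * t + 4 * C) + 2 / (1 + Ψ v) := by
  have hcap : Measurable fun x => min (tailPart M x ^ 2) v :=
    ((measurable_tailPart M).pow_const 2).min measurable_const
  have hsub : {ω | t < ∑ i, tailPart M (X i ω) ^ 2} ⊆
      {ω | t ≤ ∑ i, min (tailPart M (X i ω) ^ 2) v} ∪ {ω | v < maxAbs X ω ^ 2} := by
    refine fun ω (hω : t < _) => or_iff_not_imp_right.2 fun hmax => ?_
    have hcoord (i : Fin n) : tailPart M (X i ω) ^ 2 ≤ v := (not_lt.1 hmax).trans' <| sq_le_sq.2 <|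
      ((abs_tailPart_le M _).trans (abs_le_maxAbs X i ω)).trans (le_abs_self _)
    exact hω.le.trans_eq (Finset.sum_congr rfl fun i _ => (min_eq_left (hcoord i)).symm)
  have hchernoff := measure_sum_ge_le_exp_sum_integral_exp_sub_one (fun i => hcap.comp (hX i))
    (hind.comp (fun _ => _) fun _ => hcap) hl
    (fun i => integrable_exp_mul_min (((measurable_tailPart M).comp (hX i)).pow_const 2) hl) t
  have hsum := sum_integral_exp_min_sq_tailPart_sub_one_le hX hind hM h hΨ hl hv hC hexp
  calc _ ≤ _ := (measureReal_mono hsub).trans (measureReal_union_le _ _)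
    _ ≤ _ := add_le_add (hchernoff.trans (Real.exp_le_exp.2 (add_le_add le_rfl hsum)))
        (measureReal_lt_le_two_div h ((measurable_maxAbs hX).pow_const 2)
          (fun ω => sq_nonneg _) hΨ hv)

theorem le_two_div_one_add_half {q y : ℝ} (hy : 0 ≤ y) (hq : q ≤ 1) (hqy : q ≤ 3 / (1 + y)) :
    q ≤ 2 / (1 + 1 / 2 * y) := by
  obtain hy2 | hy2 := le_total y 2
  · refine hq.trans ((one_le_div (by positivity)).2 (by linarith))
  · refine hqy.trans ?_
    rw [div_le_div_iff₀ (by positivity) (by positivity)]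
    linarith

theorem SatisfiesHJ.exists_measure_lt_sum_sq_tailPart_le (h : IsOrlicz Ψ) (hHJ : SatisfiesHJ Ψ) :
    ∃ γ : ℝ, 0 < γ ∧ ∀ {Ω : Type*} [MeasurableSpace Ω] {μ : Measure Ω} [IsProbabilityMeasure μ]
      {n : ℕ} {X : Fin n → Ω → ℝ} {M : ℝ}, (∀ i, Measurable (X i)) → iIndepFun X μ →
      1 / 2 ≤ μ {ω | maxAbs X ω < M} → ∫⁻ ω, ENNReal.ofReal (Ψ (maxAbs X ω ^ 2)) ∂μ ≤ 1 →
      ∀ t : ℝ, 0 < t →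
        μ.real {ω | t < ∑ i, tailPart M (X i ω) ^ 2} ≤ 2 / (1 + Ψ (γ * t)) := by
  obtain ⟨A, D, hA, hD, hexp⟩ := hHJ.exists_exp_mul_sub_one_le h
  have : 0 < A * (1 + 4 * D) := by positivity
  refine ⟨1 / 2 * (A * (1 + 4 * D))⁻¹, by positivity, ?_⟩
  intro Ω _ μ _ n X M hX hind hM hΨ t ht
  set v := (A * (1 + 4 * D))⁻¹ * t with hv
  have hv0 : 0 < v := by positivity
  have hψv := h.orliczExponent_nonneg hv0.le
  have hΨv := h.nonneg hv0.le
  -- `v` is chosen so that the Chernoff exponent is exactly `-ψ v`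
  have hexponent : -(orliczExponent Ψ v / (A * v)) * t + 4 * (D * orliczExponent Ψ v) =
      -orliczExponent Ψ v := by
    rw [show t = A * (1 + 4 * D) * v by rw [hv]; field_simp]
    field_simp
    ring
  have htail : μ.real {ω | t < ∑ i, tailPart M (X i ω) ^ 2} ≤ 3 / (1 + Ψ v) := by
    refine (measure_lt_sum_sq_tailPart_le_add hX hind hM h hΨ (by positivity) hv0.le
      (by positivity) (hexp v) t).trans_eq ?_
    rw [hexponent, Real.exp_neg, h.exp_orliczExponent hv0.le]
    ring
  refine (le_two_div_one_add_half hΨv measureReal_le_one htail).trans ?_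
  have hhalf : Ψ (1 / 2 * v) ≤ 1 / 2 * Ψ v := h.map_mul_le (by norm_num) (by norm_num) hv0.le
  have hpos := h.nonneg (show 0 ≤ 1 / 2 * v by positivity)
  rw [mul_assoc, ← hv]
  gcongr

end LargeCoordinatesTail

section OrliczNorm

variable {Φ : ℝ → ℝ}

theorem IsOrlicz.of_eq_comp_sq {Ψ : ℝ → ℝ} (h : IsOrlicz Ψ)
    (hΦ : ∀ x : ℝ, 0 ≤ x → Φ x = Ψ (x ^ 2)) : IsOrlicz Φ where
  convexOn := by
    refine ⟨convex_Ici 0, fun x hx y hy a b ha hb hab => ?_⟩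
    have hx0 : 0 ≤ x := hx
    have hy0 : 0 ≤ y := hy
    simp only [smul_eq_mul]
    rw [hΦ _ (by positivity), hΦ x hx0, hΦ y hy0]
    refine (h.mono (by positivity) ((even_two.convexOn_pow (𝕜 := ℝ)).2 (Set.mem_univ x)
      (Set.mem_univ y) ha hb hab)).trans ?_
    exact h.convexOn.2 (Set.mem_Ici.2 (sq_nonneg x)) (Set.mem_Ici.2 (sq_nonneg y)) ha hb hab
  strictMonoOn x hx y hy hxy := by
    rw [hΦ x hx, hΦ y hy]
    exact h.strictMonoOn (sq_nonneg x) (sq_nonneg y) (pow_lt_pow_left₀ hxy hx two_ne_zero)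
  map_zero := by simpa [h.map_zero] using hΦ 0 le_rfl

variable {Ω : Type*} [MeasurableSpace Ω] {μ : Measure Ω} {Y : Ω → ℝ}

theorem exists_lintegral_le_one_of_orliczNorm_lt {b : ℝ≥0∞} (h : orliczNorm Φ Y μ < b) :
    ∃ a : ℝ, 0 < a ∧ ∫⁻ ω, ENNReal.ofReal (Φ (|Y ω| / a)) ∂μ ≤ 1 ∧ ENNReal.ofReal a < b := by
  simpa only [orliczNorm, iInf_lt_iff, exists_prop] using h

theorem exists_lintegral_le_one_lt_two_mul (hfin : orliczNorm Φ Y μ ≠ ∞)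
    (hpos : orliczNorm Φ Y μ ≠ 0) :
    ∃ a : ℝ, 0 < a ∧ ∫⁻ ω, ENNReal.ofReal (Φ (|Y ω| / a)) ∂μ ≤ 1 ∧
      a < 2 * (orliczNorm Φ Y μ).toReal := by
  have hL : 0 < (orliczNorm Φ Y μ).toReal := ENNReal.toReal_pos hpos hfin
  have hlt : orliczNorm Φ Y μ < ENNReal.ofReal (2 * (orliczNorm Φ Y μ).toReal) := by
    rw [ENNReal.lt_ofReal_iff_toReal_lt hfin]
    linarith
  obtain ⟨a, ha, hadm, ha_lt⟩ := exists_lintegral_le_one_of_orliczNorm_lt hlt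
  exact ⟨a, ha, hadm, (ENNReal.ofReal_lt_ofReal_iff (by positivity)).1 ha_lt⟩

namespace IsOrlicz

theorem lintegral_abs_le_mul_orliczNorm [IsProbabilityMeasure μ] (h : IsOrlicz Φ) :
    ∫⁻ ω, ENNReal.ofReal |Y ω| ∂μ ≤ ENNReal.ofReal (1 + 1 / Φ 1) * orliczNorm Φ Y μ := by
  have hΦ1 := h.pos one_pos
  rw [← ENNReal.div_le_iff' (by positivity) ENNReal.ofReal_ne_top]
  refine le_iInf fun a => le_iInf fun ha => le_iInf fun hadm => ?_
  rw [ENNReal.div_le_iff' (by positivity) ENNReal.ofReal_ne_top,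
    ← ENNReal.ofReal_mul (by positivity)]
  have hpoint (ω : Ω) : |Y ω| ≤ a + a / Φ 1 * Φ (|Y ω| / a) := by
    have hle := (div_le_iff₀ ha).1 (h.le_one_add_map_div (x := |Y ω| / a) (by positivity))
    exact hle.trans_eq (by ring)
  have hΦ0 (ω : Ω) := h.nonneg (x := |Y ω| / a) (by positivity)
  calc ∫⁻ ω, ENNReal.ofReal |Y ω| ∂μ
      ≤ ∫⁻ ω, (ENNReal.ofReal a +
          ENNReal.ofReal (a / Φ 1) * ENNReal.ofReal (Φ (|Y ω| / a))) ∂μ :=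
        lintegral_mono fun ω => by
          rw [← ENNReal.ofReal_mul (by positivity),
            ← ENNReal.ofReal_add ha.le (mul_nonneg (by positivity) (hΦ0 ω))]
          exact ENNReal.ofReal_le_ofReal (hpoint ω)
    _ = ENNReal.ofReal a +
          ENNReal.ofReal (a / Φ 1) * ∫⁻ ω, ENNReal.ofReal (Φ (|Y ω| / a)) ∂μ := by
        rw [lintegral_add_left measurable_const, lintegral_const_mul' _ _ ENNReal.ofReal_ne_top]
        simp
    _ ≤ ENNReal.ofReal a + ENNReal.ofReal (a / Φ 1) * 1 := by gcongr
    _ = ENNReal.ofReal ((1 + 1 / Φ 1) * a) := by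
        rw [mul_one, ← ENNReal.ofReal_add (by positivity) (by positivity)]
        congr 1
        ring

theorem integrable_of_orliczNorm_lt_top [IsProbabilityMeasure μ] (h : IsOrlicz Φ)
    (hY : Measurable Y) (hfin : orliczNorm Φ Y μ < ∞) : Integrable Y μ := by
  refine ⟨hY.aestronglyMeasurable, hasFiniteIntegral_iff_norm Y |>.2 ?_⟩
  exact h.lintegral_abs_le_mul_orliczNorm.trans_lt (ENNReal.mul_lt_top ENNReal.ofReal_lt_top hfin)

theorem orliczNorm_ne_zero [IsProbabilityMeasure μ] (h : IsOrlicz Φ)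
    (hY : ∫ ω, Y ω ∂μ ≠ 0) : orliczNorm Φ Y μ ≠ 0 := by
  intro h0
  have hlint := h.lintegral_abs_le_mul_orliczNorm (Y := Y) (μ := μ)
  rw [h0, mul_zero] at hlint
  have hle := norm_integral_le_lintegral_norm (μ := μ) Y
  simp only [Real.norm_eq_abs] at hle
  rw [le_antisymm hlint zero_le, ENNReal.toReal_zero] at hle
  exact hY (abs_nonpos_iff.1 hle)

end IsOrlicz

end OrliczNorm

section Deviation

variable {Ω : Type*} [MeasurableSpace Ω] {μ : Measure Ω}

theorem measure_lt_abs_sub_integral_le_add [IsFiniteMeasure μ] {Y Y' R : Ω → ℝ} {s u v : ℝ}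
    (hY : Integrable Y μ) (hY' : Integrable Y' μ) (hR : Integrable R μ)
    (hYR : ∀ ω, |Y ω - Y' ω| ≤ R ω) (hv : ∫ ω, R ω ∂μ ≤ v) :
    μ.real {ω | s + u + v < |Y ω - ∫ ω', Y ω' ∂μ|} ≤
      μ.real {ω | s ≤ |Y' ω - ∫ ω', Y' ω' ∂μ|} + μ.real {ω | u < R ω} := by
  have hmean : |∫ ω, Y' ω ∂μ - ∫ ω, Y ω ∂μ| ≤ v := by
    rw [abs_sub_comm, ← integral_sub hY hY']
    exact (abs_integral_le_integral_abs.trans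
      (integral_mono (hY.sub hY').abs hR hYR)).trans hv
  refine (measureReal_mono fun ω (hω : s + u + v < _) => ?_).trans (measureReal_union_le _ _)
  by_contra hcon
  obtain ⟨hs, hu⟩ := not_or.1 hcon
  have hs' : |Y' ω - ∫ ω', Y' ω' ∂μ| < s := not_le.1 hs
  have hu' : R ω ≤ u := not_lt.1 hu
  have htri := (abs_sub_le (Y ω) (Y' ω) (∫ ω, Y ω ∂μ)).trans
    (add_le_add_right (abs_sub_le (Y' ω) (∫ ω, Y' ω ∂μ) (∫ ω, Y ω ∂μ)) _)
  linarith [hYR ω]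

variable {n : ℕ} {X : Fin n → Ω → ℝ}

theorem integrable_norm_randVec_tailPart (hX : ∀ i, Measurable (X i))
    (hint : Integrable (maxAbs X) μ) (M : ℝ) :
    Integrable (fun ω => ‖randVec (fun i ω => tailPart M (X i ω)) ω‖) μ := by
  refine (integrable_finsetSum (Finset.univ : Finset (Fin n)) fun _ _ => hint).mono'
    (measurable_randVec fun i => (measurable_tailPart M).comp (hX i)).norm.aestronglyMeasurable
    (ae_of_all _ fun ω => ?_)
  rw [norm_norm]
  exact (norm_randVec_le_sum _ ω).trans (Finset.sum_le_sum fun i _ =>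
    (abs_tailPart_le M (X i ω)).trans (abs_le_maxAbs X i ω))

theorem integral_norm_randVec_tailPart_le (hX : ∀ i, Measurable (X i)) (hind : iIndepFun X μ)
    (hint : Integrable (maxAbs X) μ) {M : ℝ} (hM : 1 / 2 ≤ μ {ω | maxAbs X ω < M}) :
    ∫ ω, ‖randVec (fun i ω => tailPart M (X i ω)) ω‖ ∂μ ≤ 2 * ∫ ω, maxAbs X ω ∂μ := by
  have hmax0 : 0 ≤ ∫ ω, maxAbs X ω ∂μ := integral_nonneg (maxAbs_nonneg X)
  rw [← ENNReal.ofReal_le_ofReal_iff (by positivity), ofReal_integral_eq_lintegral_ofReal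
    (integrable_norm_randVec_tailPart hX hint M) (ae_of_all _ fun ω => norm_nonneg _)]
  calc _ ≤ ∫⁻ ω, ∑ i, ENNReal.ofReal |tailPart M (X i ω)| ∂μ := lintegral_mono fun ω => by
        rw [← ENNReal.ofReal_sum_of_nonneg fun i _ => abs_nonneg _]
        exact ENNReal.ofReal_le_ofReal (norm_randVec_le_sum _ ω)
    _ = ∑ i, ∫⁻ ω, ENNReal.ofReal |tailPart M (X i ω)| ∂μ := lintegral_finsetSum _ fun i _ =>
        ((measurable_tailPart M).comp (hX i)).abs.ennreal_ofReal
    _ ≤ 2 * ∫⁻ ω, ENNReal.ofReal (maxAbs X ω) ∂μ :=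
        sum_lintegral_tailPart_le hX hind hM ENNReal.measurable_ofReal ENNReal.ofReal_zero
    _ = _ := by
        rw [← ofReal_integral_eq_lintegral_ofReal hint (ae_of_all _ (maxAbs_nonneg X)),
          ENNReal.ofReal_mul zero_le_two, ENNReal.ofReal_ofNat]

variable [IsProbabilityMeasure μ]

theorem integrable_comp_randVec (hX : ∀ i, Measurable (X i)) (hint : Integrable (maxAbs X) μ)
    {f : EuclideanSpace ℝ (Fin n) → ℝ} {K : NNReal} (hL : LipschitzWith K f) :
    Integrable (fun ω => f (randVec X ω)) μ := by
  refine ((integrable_const |f 0|).add (hint.const_mul (K * n))).mono'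
    (hL.continuous.measurable.comp (measurable_randVec hX)).aestronglyMeasurable
    (ae_of_all _ fun ω => ?_)
  have hdist : |f (randVec X ω) - f 0| ≤ K * ‖randVec X ω‖ := by
    simpa [Real.dist_eq] using hL.dist_le_mul (randVec X ω) 0
  calc |f (randVec X ω)| ≤ |f 0| + |f (randVec X ω) - f 0| := by
        linarith [abs_sub_abs_le_abs_sub (f (randVec X ω)) (f 0)]
    _ ≤ |f 0| + K * (n * maxAbs X ω) := by
        gcongr
        exact hdist.trans (by gcongr; exact norm_randVec_le_card_mul_maxAbs X ω)
    _ = |f 0| + K * n * maxAbs X ω := by ring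

theorem measureReal_deviation_eq_zero (hint : Integrable (maxAbs X) μ)
    (h0 : ∫ ω, maxAbs X ω ∂μ = 0) (f : EuclideanSpace ℝ (Fin n) → ℝ) {t : ℝ} (ht : 0 ≤ t) :
    μ.real {ω | t < |f (randVec X ω) - ∫ ω', f (randVec X ω') ∂μ|} = 0 := by
  have hconst : ∀ᵐ ω ∂μ, f (randVec X ω) = f 0 := by
    filter_upwards [(integral_eq_zero_iff_of_nonneg (maxAbs_nonneg X) hint).1 h0] with ω hω
    have hnorm := norm_randVec_le_card_mul_maxAbs X ω
    rw [hω, Pi.zero_apply, mul_zero] at hnorm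
    rw [norm_le_zero_iff.1 hnorm]
  have hmean : ∫ ω, f (randVec X ω) ∂μ = f 0 := by
    simp [integral_congr_ae hconst]
  rw [measureReal_eq_zero_iff, measure_eq_zero_iff_ae_notMem]
  filter_upwards [hconst] with ω hω
  simpa [hmean, hω] using ht

theorem integrable_maxAbs_of_bound (hX : ∀ i, Measurable (X i)) {M : NNReal}
    (hb : ∀ i ω, |X i ω| ≤ M) : Integrable (maxAbs X) μ :=
  .of_bound (measurable_maxAbs hX).aestronglyMeasurable M <| ae_of_all _ fun ω =>
    (Real.norm_of_nonneg (maxAbs_nonneg X ω)).trans_le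
      (Real.iSup_le (fun i => hb i ω) NNReal.zero_le_coe)

theorem measure_deviation_of_bound_le (hX : ∀ i, Measurable (X i)) (hind : iIndepFun X μ)
    {M : NNReal} (hM : 0 < M) (hb : ∀ i ω, |X i ω| ≤ M) {f : EuclideanSpace ℝ (Fin n) → ℝ}
    (hf : ConvexOn ℝ Set.univ f) (hL : LipschitzWith 1 f) {t : ℝ} (ht : 0 ≤ t) :
    μ.real {ω | t ≤ |f (randVec X ω) - ∫ ω', f (randVec X ω') ∂μ|} ≤
      2 * Real.exp (-(t ^ 2 / (32 * M ^ 2))) := by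
  refine (measure_abs_ge_le_of_hasSubgaussianMGF
    (hasSubgaussianMGF_comp_randVec hM hX hind hb hf hL) ht).trans_eq ?_
  simp only [NNReal.coe_mul, NNReal.coe_pow, NNReal.coe_ofNat, NNReal.coe_one]
  rw [neg_div]
  ring_nf

theorem measure_deviation_le_exp_add_measure_tailPart (hX : ∀ i, Measurable (X i))
    (hind : iIndepFun X μ) (hint : Integrable (maxAbs X) μ) (hm : 0 < ∫ ω, maxAbs X ω ∂μ)
    {f : EuclideanSpace ℝ (Fin n) → ℝ} (hf : ConvexOn ℝ Set.univ f) (hL : LipschitzWith 1 f)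
    {t : ℝ} (ht : 8 * ∫ ω, maxAbs X ω ∂μ ≤ t) :
    μ.real {ω | t < |f (randVec X ω) - ∫ ω', f (randVec X ω') ∂μ|} ≤
      2 * Real.exp (-(1 / 2048 * (t ^ 2 / (∫ ω, maxAbs X ω ∂μ) ^ 2))) +
        μ.real {ω | t / 2 <
          ‖randVec (fun i ω => tailPart (2 * ∫ ω', maxAbs X ω' ∂μ) (X i ω)) ω‖} := by
  set m := ∫ ω, maxAbs X ω ∂μ
  set X' : Fin n → Ω → ℝ := fun i ω => X i ω - tailPart (2 * m) (X i ω) with hX'_def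
  have htrunc : Measurable fun x => x - tailPart (2 * m) x :=
    measurable_id.sub (measurable_tailPart _)
  have hX' (i : Fin n) : Measurable (X' i) := htrunc.comp (hX i)
  have hcoe : ((2 * m).toNNReal : ℝ) = 2 * m := Real.coe_toNNReal _ (by positivity)
  have hbdd (i : Fin n) (ω : Ω) : |X' i ω| ≤ (2 * m).toNNReal :=
    (abs_sub_tailPart_le (by positivity) _).trans_eq hcoe.symm
  have hmain := measure_deviation_of_bound_le hX' (hind.comp (fun _ => _) fun _ => htrunc)
    (Real.toNNReal_pos.2 (by positivity)) hbdd hf hL (t := t / 4) (by linarith)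
  have hclose (ω : Ω) : |f (randVec X ω) - f (randVec X' ω)| ≤
      ‖randVec (fun i ω => tailPart (2 * m) (X i ω)) ω‖ := by
    have hsplit : randVec X ω - randVec X' ω =
        randVec (fun i ω => tailPart (2 * m) (X i ω)) ω := by
      ext i
      simp [randVec, hX'_def]
    rw [← hsplit]
    simpa [Real.dist_eq, dist_eq_norm] using hL.dist_le_mul (randVec X ω) (randVec X' ω)
  have hmean := integral_norm_randVec_tailPart_le hX hind hint
    (half_le_measure_lt_two_mul_integral (maxAbs_nonneg X) (measurable_maxAbs hX) hint hm)
  have hpert := measure_lt_abs_sub_integral_le_add (s := t / 4) (u := t / 2) (v := t / 4)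
    (integrable_comp_randVec hX hint hL)
    (integrable_comp_randVec hX' (integrable_maxAbs_of_bound hX' hbdd) hL)
    (integrable_norm_randVec_tailPart hX hint (2 * m)) hclose (by linarith)
  rw [show t / 4 + t / 2 + t / 4 = t by ring] at hpert
  rw [hcoe, show (t / 4) ^ 2 / (32 * (2 * m) ^ 2) = 1 / 2048 * (t ^ 2 / m ^ 2) by ring] at hmain
  exact hpert.trans (add_le_add hmain le_rfl)

variable {Ψ : ℝ → ℝ}

theorem SatisfiesHJ.exists_measure_lt_norm_randVec_tailPart_le (h : IsOrlicz Ψ)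
    (hHJ : SatisfiesHJ Ψ) :
    ∃ γ : ℝ, 0 < γ ∧ ∀ {Ω : Type*} [MeasurableSpace Ω] {μ : Measure Ω} [IsProbabilityMeasure μ]
      {n : ℕ} {X : Fin n → Ω → ℝ} {M a : ℝ}, (∀ i, Measurable (X i)) → iIndepFun X μ →
      1 / 2 ≤ μ {ω | maxAbs X ω < M} → 0 < a →
      ∫⁻ ω, ENNReal.ofReal (Ψ ((maxAbs X ω / a) ^ 2)) ∂μ ≤ 1 → ∀ t : ℝ, 0 < t →
        μ.real {ω | t < ‖randVec (fun i ω => tailPart M (X i ω)) ω‖} ≤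
          2 / (1 + Ψ (γ * (t / a) ^ 2)) := by
  obtain ⟨γ, hγ, htail⟩ := hHJ.exists_measure_lt_sum_sq_tailPart_le h
  refine ⟨γ, hγ, fun {Ω _ μ _ n X M a} hX hind hM ha hΨ t ht => ?_⟩
  have hbound := htail (M := M / a) (fun i => (hX i).div_const a)
    (hind.comp (fun _ x => x / a) fun _ => measurable_id.div_const a)
    (by simpa only [maxAbs_div X ha.le, div_lt_div_iff_of_pos_right ha] using hM)
    (by simpa only [maxAbs_div X ha.le] using hΨ) ((t / a) ^ 2) (by positivity)
  refine le_trans (measureReal_mono fun ω (hω : t < _) => ?_) hbound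
  have hsq := pow_lt_pow_left₀ hω ht.le two_ne_zero
  rw [EuclideanSpace.norm_sq_eq] at hsq
  simp only [randVec, Real.norm_eq_abs, sq_abs] at hsq
  simp only [Set.mem_ofPred_eq, tailPart_div ha, div_pow, ← Finset.sum_div]
  gcongr

theorem SatisfiesHJ.exists_measure_deviation_le (h : IsOrlicz Ψ) (hHJ : SatisfiesHJ Ψ) :
    ∃ γ : ℝ, 0 < γ ∧ ∀ {Ω : Type*} [MeasurableSpace Ω] {μ : Measure Ω} [IsProbabilityMeasure μ]
      {n : ℕ} {X : Fin n → Ω → ℝ} {a : ℝ}, (∀ i, Measurable (X i)) → iIndepFun X μ →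
      Integrable (maxAbs X) μ → 0 < ∫ ω, maxAbs X ω ∂μ → 0 < a →
      ∫⁻ ω, ENNReal.ofReal (Ψ ((maxAbs X ω / a) ^ 2)) ∂μ ≤ 1 →
      ∀ {f : EuclideanSpace ℝ (Fin n) → ℝ}, ConvexOn ℝ Set.univ f → LipschitzWith 1 f →
      ∀ {t : ℝ}, 0 < t →
        μ.real {ω | t < |f (randVec X ω) - ∫ ω', f (randVec X ω') ∂μ|} ≤
          2 * Real.exp (-(1 / 2048 * (t ^ 2 / (∫ ω, maxAbs X ω ∂μ) ^ 2))) +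
            2 / (1 + Ψ (γ * (t / a) ^ 2)) := by
  obtain ⟨γ, hγ, htail⟩ := hHJ.exists_measure_lt_norm_randVec_tailPart_le h
  refine ⟨γ / 4, by positivity, fun {Ω _ μ _ n X a} hX hind hint hm ha hΨ f hf hL t ht => ?_⟩
  obtain htm | htm := lt_or_ge t (8 * ∫ ω, maxAbs X ω ∂μ)
  · have hratio : t ^ 2 / (∫ ω, maxAbs X ω ∂μ) ^ 2 ≤ 64 := by
      rw [div_le_iff₀ (by positivity)]
      nlinarith
    have hexp := Real.add_one_le_exp (-(1 / 2048 * (t ^ 2 / (∫ ω, maxAbs X ω ∂μ) ^ 2)))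
    have hΨ0 : 0 ≤ Ψ (γ / 4 * (t / a) ^ 2) := h.nonneg (by positivity)
    have hlast : 0 ≤ 2 / (1 + Ψ (γ / 4 * (t / a) ^ 2)) := by positivity
    exact measureReal_le_one.trans (by linarith)
  · have hhalf := half_le_measure_lt_two_mul_integral (maxAbs_nonneg X) (measurable_maxAbs hX)
      hint hm
    have hlarge := htail hX hind hhalf ha hΨ (t / 2) (by positivity)
    rw [show γ * (t / 2 / a) ^ 2 = γ / 4 * (t / a) ^ 2 by ring] at hlarge
    exact (measure_deviation_le_exp_add_measure_tailPart hX hind hint hm hf hL htm).trans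
      (add_le_add le_rfl hlarge)

theorem IsOrlicz.two_div_one_add_map_le (h : IsOrlicz Ψ) {x y : ℝ} (hx : 0 ≤ x) (hxy : x ≤ y) :
    2 / (1 + Ψ y) ≤ 2 / (1 + Ψ x) := by
  have hΨx := h.nonneg hx
  gcongr
  exact h.mono hx hxy

theorem sq_mul_div_le {c γ t a L : ℝ} (hγ : 0 ≤ γ) (hc : 0 ≤ c) (hcγ : c ≤ √γ / 2) (ht : 0 ≤ t)
    (ha : 0 < a) (haL : a ≤ 2 * L) : (c * (t / L)) ^ 2 ≤ γ * (t / a) ^ 2 := by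
  have hL : 0 < L := by linarith
  calc (c * (t / L)) ^ 2 ≤ (√γ / 2 * (t / L)) ^ 2 := by gcongr
    _ = γ * (t / (2 * L)) ^ 2 := by
        rw [mul_pow, div_pow, Real.sq_sqrt hγ]
        ring
    _ ≤ γ * (t / a) ^ 2 := by gcongr

end Deviation

theorem proposition4p6 (Ψ Φ : ℝ → ℝ) (hΨ : IsOrlicz Ψ) (hHJ : SatisfiesHJ Ψ)
    (hΦ : ∀ x : ℝ, 0 ≤ x → Φ x = Ψ (x ^ 2)) :
    ∃ c : ℝ, 0 < c ∧
      ∀ {Ω : Type*} [MeasurableSpace Ω] (μ : Measure Ω) [IsProbabilityMeasure μ]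
        (N : ℕ) (X : Fin N → Ω → ℝ),
        (∀ i, Measurable (X i)) → iIndepFun X μ → orliczNorm Φ (maxAbs X) μ < ∞ →
        ∀ f : EuclideanSpace ℝ (Fin N) → ℝ, ConvexOn ℝ Set.univ f → LipschitzWith 1 f →
          Integrable (maxAbs X) μ ∧ Integrable (fun ω => f (randVec X ω)) μ ∧
          ∀ t : ℝ, 0 < t →
            ((∫ ω, maxAbs X ω ∂μ) ≠ 0 →
              μ.real {ω | t < |f (randVec X ω) - ∫ ω', f (randVec X ω') ∂μ|} ≤
                2 * Real.exp (-(c * (t ^ 2 / (∫ ω, maxAbs X ω ∂μ) ^ 2))) +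
                  2 / (Φ (c * (t / (orliczNorm Φ (maxAbs X) μ).toReal)) + 1)) ∧
            -- the degenerate case `X = 0` almost surely, where the bound is read as `0`
            ((∫ ω, maxAbs X ω ∂μ) = 0 →
              μ.real {ω | t < |f (randVec X ω) - ∫ ω', f (randVec X ω') ∂μ|} = 0) := by
  obtain ⟨γ, hγ, hdev⟩ := hHJ.exists_measure_deviation_le hΨ
  have hΦO : IsOrlicz Φ := hΨ.of_eq_comp_sq hΦ
  refine ⟨min (1 / 2048) (√γ / 2), by positivity, fun {Ω _} μ _ N X hX hind hfin f hf hL => ?_⟩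
  have hint := hΦO.integrable_of_orliczNorm_lt_top (measurable_maxAbs hX) hfin
  refine ⟨hint, integrable_comp_randVec hX hint hL, fun t ht => ⟨fun hm0 => ?_, fun hm0 =>
    measureReal_deviation_eq_zero hint hm0 f ht.le⟩⟩
  have hm : 0 < ∫ ω, maxAbs X ω ∂μ := (integral_nonneg (maxAbs_nonneg X)).lt_of_ne' hm0
  obtain ⟨a, ha, hadm, haL⟩ :=
    exists_lintegral_le_one_lt_two_mul hfin.ne (hΦO.orliczNorm_ne_zero hm0)
  have hadm_sq : ∫⁻ ω, ENNReal.ofReal (Ψ ((maxAbs X ω / a) ^ 2)) ∂μ ≤ 1 := by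
    simpa only [abs_of_nonneg (maxAbs_nonneg X _), hΦ _ (div_nonneg (maxAbs_nonneg X _) ha.le)]
      using hadm
  refine (hdev hX hind hint hm ha hadm_sq hf hL ht).trans (add_le_add ?_ ?_)
  · gcongr
    exact min_le_left _ _
  · rw [hΦ _ (by positivity), add_comm (Ψ _)]
    exact hΨ.two_div_one_add_map_le (by positivity)
      (sq_mul_div_le hγ.le (by positivity) (min_le_right _ _) ht.le ha haL.le)
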